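/- Let $(\mathbf Y,h)=(\mathbb S^2\setminus\{c_1,c_2,c_3\},h)$ be the thrice-punctured sphere with its complete finite-area hyperbolic metric of curvature $-1$ (unique up to isometry), realised as $\Gamma(2)\backslash\mathbb H$, where $\mathbb H$ is the hyperbolic plane and $\Gamma(2)$ is the principal congruence subgroup of level $2$ of $\mathrm{SL}_2(\mathbb Z)$. Let $[c_1],[c_2],[c_3]\in\pi_1(\mathbf Y)$ be elements with $[c_1][c_2][c_3]=1$ such that $[c_i]$ is freely homotopic to a small consistently oriented simple closed curve around the puncture $c_i$, $i=1,2,3$. A *standard figure-eight geodesic* is a closed geodesic in the free homotopy class $[c_i][c_j]^{-1}$ for some $i\neq j$. A *self-intersection* of a closed geodesic $\gamma:\mathbb R/L\mathbb Z\to\mathbf Y$ is an unordered pair of distinct parameters $s\neq t$ in $\mathbb R/L\mathbb Z$ with $\gamma(s)=\gamma(t)$. Let $\gamma$ be a closed (not necessarily primitive) geodesic in $(\mathbf Y,h)$. Then: 1. $\gamma$ has at least one self-intersection. 2. $\gamma$ has exactly one self-intersection if and only if it is a standard figure-eight geodesic. -/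

import Mathlib

noncomputable section

open scoped UpperHalfPlane MatrixGroups unitInterval

namespace ThricePuncturedSphere

/-- The hyperbolic thrice-punctured sphere `(Y, h)`, in its standard model `Γ(2) \ ℍ`, with the
quotient topology.  The group `Γ(2)` acts on `ℍ` through the torsion-free group `Γ(2) / {±1}` of
orientation-preserving isometries, and a fundamental domain consists of two adjacent ideal
triangles, glued along their sides to a sphere with three punctures (the cusps `∞`, `0`, `1`);
equivalently, the modular function `lambda` identifies `Γ(2) \ ℍ` with `ℂ \ {0, 1}`.
The complete, finite-area metric `h` of curvature `-1` is the one for which the projection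
`ℍ → Y` is a Riemannian covering; it is unique up to isometry. -/
abbrev Y : Type := MulAction.orbitRel.Quotient (CongruenceSubgroup.Gamma 2) ℍ

/-- The covering projection `ℍ → Y`. -/
def proj (z : ℍ) : Y := Quotient.mk _ z

lemma continuous_proj : Continuous proj := continuous_quotient_mk'

lemma proj_smul (g : SL(2, ℤ)) (hg : g ∈ CongruenceSubgroup.Gamma 2) (z : ℍ) :
    proj (g • z) = proj z :=
  Quotient.sound ⟨⟨g, hg⟩, rfl⟩

/-- A unit-speed parametrized geodesic `ℝ → Y` of the metric `h`: the projection of a geodesic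
line of the hyperbolic plane, that is, of an isometric embedding `ℝ → ℍ`. -/
def IsGeodesic (γ : ℝ → Y) : Prop :=
  ∃ lift : ℝ → ℍ, Isometry lift ∧ ∀ t, γ t = proj (lift t)

/-- A closed geodesic of `(Y, h)`, parametrized by arc length, of length `length`.
It need not be primitive: `length` may be any positive period. -/
structure ClosedGeodesic where
  /-- the parametrization -/
  toFun : ℝ → Y
  /-- the length -/
  length : ℝ
  length_pos : 0 < length
  periodic : Function.Periodic toFun length
  isGeodesic : IsGeodesic toFun

/-- The self-intersections of a closed geodesic `γ : ℝ / length ℤ → Y`: the unordered pairs of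
distinct parameters that have the same image.  Each such pair is listed once, by its
representatives `s < t` in `[0, length)`. -/
def ClosedGeodesic.selfIntersections (γ : ClosedGeodesic) : Set (ℝ × ℝ) :=
  {p | 0 ≤ p.1 ∧ p.1 < p.2 ∧ p.2 < γ.length ∧ γ.toFun p.1 = γ.toFun p.2}

/-- A closed geodesic as a loop parametrized by the unit interval. -/
def ClosedGeodesic.loop (γ : ClosedGeodesic) : Path (γ.toFun 0) (γ.toFun 0) where
  toFun t := γ.toFun (γ.length * t)
  continuous_toFun := by
    obtain ⟨lift, hl, hγ⟩ := γ.isGeodesic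
    simp only [hγ]
    exact continuous_proj.comp (hl.continuous.comp (by fun_prop))
  source' := by simp
  target' := by simpa using γ.periodic 0

/-- Free homotopy of loops, with possibly different base points: a homotopy through loops. -/
def FreelyHomotopic {x y : Y} (p : Path x x) (q : Path y y) : Prop :=
  ∃ H : C(I × I, Y), (∀ t, H (0, t) = p t) ∧ (∀ t, H (1, t) = q t) ∧ ∀ s, H (s, 0) = H (s, 1)

/-- Elements of `SL(2, ℤ)` that carry the cusp `∞` to the three cusps `∞`, `0`, `1` of `Y`. -/
def cuspMap : Fin 3 → SL(2, ℤ) :=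
  ![1, ModularGroup.S, ModularGroup.T * ModularGroup.S]

lemma proj_cuspMap_translate (i : Fin 3) (z : ℍ) :
    proj (cuspMap i • ((2 : ℝ) +ᵥ z)) = proj (cuspMap i • z) := by
  have hT : ModularGroup.T ^ (2 : ℤ) ∈ CongruenceSubgroup.Gamma 2 := by
    rw [CongruenceSubgroup.Gamma_mem, ModularGroup.coe_T_zpow]
    decide
  have h := proj_smul _ ((CongruenceSubgroup.Gamma_normal 2).conj_mem _ hT (cuspMap i))
    (cuspMap i • z)
  rw [← h]
  congr 1
  rw [mul_smul, mul_smul, inv_smul_smul, UpperHalfPlane.modular_T_zpow_smul]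
  norm_num

/-- The positively oriented horocycle around the `i`-th cusp: for the cusp `∞` it is the image in
`Y` of the horizontal segment from `2 * Complex.I` to `2 * Complex.I + 2`, and for the other cusps
the translate of this by `cuspMap i`, which preserves the orientation.  These are three small
pairwise disjoint consistently oriented simple closed curves around the three punctures. -/
def horocycle (i : Fin 3) :
    Path (proj (cuspMap i • (⟨2 * Complex.I, by simp⟩ : ℍ)))
      (proj (cuspMap i • (⟨2 * Complex.I, by simp⟩ : ℍ))) where
  toFun t := proj (cuspMap i • ((2 * (t : ℝ)) +ᵥ (⟨2 * Complex.I, by simp⟩ : ℍ)))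
  continuous_toFun := by
    refine continuous_proj.comp (Continuous.const_smul ?_ _)
    rw [UpperHalfPlane.isEmbedding_coe.continuous_iff]
    simp only [Function.comp_def, UpperHalfPlane.coe_vadd]
    fun_prop
  source' := by simp
  target' := by simpa using proj_cuspMap_translate i _

/-- Loops `c 0`, `c 1`, `c 2` at a common base point are standard peripheral generators of the
fundamental group if `c i` is freely homotopic to a small positively oriented simple closed curve
around the `i`-th puncture and `[c 0] [c 1] [c 2] = 1`. -/
def IsPeripheralSystem {y : Y} (c : Fin 3 → Path y y) : Prop :=
  (∀ i, FreelyHomotopic (c i) (horocycle i)) ∧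
    (((c 0).trans (c 1)).trans (c 2)).Homotopic (Path.refl y)

/-- A standard figure-eight geodesic: a closed geodesic in the free homotopy class
`[c i] [c j]⁻¹`, for some `i ≠ j`. -/
def ClosedGeodesic.IsStandardFigureEight (γ : ClosedGeodesic) : Prop :=
  ∃ (y : Y) (c : Fin 3 → Path y y), IsPeripheralSystem c ∧
    ∃ i j : Fin 3, i ≠ j ∧ FreelyHomotopic γ.loop ((c i).trans (c j).symm)

end ThricePuncturedSphere

end

noncomputable section

open scoped UpperHalfPlane MatrixGroups unitInterval

namespace ThricePuncturedSphere

open CongruenceSubgroup ModularGroup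

lemma mem_Gamma_two_iff {g : SL(2, ℤ)} :
    g ∈ Gamma 2 ↔ Odd (g 0 0) ∧ Even (g 0 1) ∧ Even (g 1 0) ∧ Odd (g 1 1) := by
  rw [Gamma_mem, ← ZMod.intCast_eq_one_iff_odd, ← ZMod.intCast_eq_one_iff_odd,
    ← ZMod.intCast_eq_zero_iff_even, ← ZMod.intCast_eq_zero_iff_even]

lemma SL2_mul_apply {R : Type*} [CommRing R] (g h : SL(2, R)) (i j : Fin 2) :
    (g * h) i j = g i 0 * h 0 j + g i 1 * h 1 j := by
  rw [Matrix.SpecialLinearGroup.coe_mul, Matrix.mul_apply, Fin.sum_univ_two]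

section inv
variable {R : Type*} [CommRing R] (g : SL(2, R))

lemma SL2_inv_zero_zero : g⁻¹ 0 0 = g 1 1 := by rw [Matrix.SpecialLinearGroup.SL2_inv_expl]; rfl

lemma SL2_inv_zero_one : g⁻¹ 0 1 = -g 0 1 := by rw [Matrix.SpecialLinearGroup.SL2_inv_expl]; rfl

lemma SL2_inv_one_zero : g⁻¹ 1 0 = -g 1 0 := by rw [Matrix.SpecialLinearGroup.SL2_inv_expl]; rfl

lemma SL2_inv_one_one : g⁻¹ 1 1 = g 0 0 := by rw [Matrix.SpecialLinearGroup.SL2_inv_expl]; rfl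

end inv

lemma det_eq (g : SL(2, ℤ)) : g 0 0 * g 1 1 - g 0 1 * g 1 0 = 1 := by
  rw [← Matrix.det_fin_two]; exact g.det_coe

lemma neg_one_mem_Gamma_two : (-1 : SL(2, ℤ)) ∈ Gamma 2 := by
  rw [mem_Gamma_two_iff]; simp

lemma neg_mem_Gamma_two {g : SL(2, ℤ)} (hg : g ∈ Gamma 2) : -g ∈ Gamma 2 := by
  simpa using mul_mem neg_one_mem_Gamma_two hg

lemma conj_mem_Gamma_two {g : SL(2, ℤ)} (hg : g ∈ Gamma 2) (h : SL(2, ℤ)) :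
    h * g * h⁻¹ ∈ Gamma 2 := (Gamma_normal 2).conj_mem _ hg h

lemma proj_eq_iff {z w : ℍ} : proj z = proj w ↔ ∃ g ∈ Gamma 2, z = g • w := by
  refine Quotient.eq''.trans ⟨fun ⟨g, hg⟩ => ⟨g, g.2, hg.symm⟩, fun ⟨g, hg, h⟩ => ⟨⟨g, hg⟩, h.symm⟩⟩

lemma proj_smul_eq_iff (h : SL(2, ℤ)) {z w : ℍ} :
    proj (h • z) = proj (h • w) ↔ proj z = proj w := by
  simp only [proj_eq_iff]
  constructor
  · rintro ⟨g, hg, e⟩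
    refine ⟨h⁻¹ * g * h⁻¹⁻¹, conj_mem_Gamma_two hg _, ?_⟩
    rw [inv_inv, mul_smul, mul_smul, ← e, inv_smul_smul]
  · rintro ⟨g, hg, e⟩
    refine ⟨h * g * h⁻¹, conj_mem_Gamma_two hg _, ?_⟩
    rw [e, mul_smul, mul_smul, inv_smul_smul]

lemma four_dvd_diag_sub {g : SL(2, ℤ)} (hg : g ∈ Gamma 2) :
    (4 : ℤ) ∣ g 0 0 - g 1 1 := by
  obtain ⟨⟨a, ha⟩, ⟨b, hb⟩, ⟨c, hc⟩, ⟨d, hd⟩⟩ := mem_Gamma_two_iff.1 hg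
  have := det_eq g
  rw [ha, hb, hc, hd] at this
  have h2 : a + d = 2 * (b * c - a * d) := by linarith
  rw [ha, hd]
  exact ⟨b * c - a * d - d, by linarith⟩

/-- An element of `Γ(2)` of trace at most `2` in absolute value has trace `± 2`. -/
lemma trace_cases {g : SL(2, ℤ)} (hg : g ∈ Gamma 2) (h : (g 0 0 + g 1 1) ^ 2 < 36) :
    g 0 0 + g 1 1 = 2 ∨ g 0 0 + g 1 1 = -2 := by
  obtain ⟨k, hk⟩ := four_dvd_diag_sub hg
  obtain ⟨⟨a, ha⟩, -, -, -⟩ := mem_Gamma_two_iff.1 hg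
  have h1 := abs_lt_of_sq_lt_sq (show (g 0 0 + g 1 1) ^ 2 < 6 ^ 2 by linarith) (by norm_num)
  rw [abs_lt] at h1
  omega

lemma eq_one_or_of_smul_eq {g : SL(2, ℤ)} (hg : g ∈ Gamma 2) {z : ℍ} (h : g • z = z) :
    g = 1 ∨ g = -1 := by
  have hz := z.im_pos
  have h1 := congrArg UpperHalfPlane.coe h
  have hden := UpperHalfPlane.denom_ne_zero (g : GL (Fin 2) ℝ) z
  rw [UpperHalfPlane.coe_specialLinearGroup_apply] at h1
  have hden' : ((algebraMap ℤ ℝ (g 1 0) : ℂ) * z + (algebraMap ℤ ℝ (g 1 1) : ℂ)) ≠ 0 := hden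
  rw [div_eq_iff hden'] at h1
  have hre := congrArg Complex.re h1
  have him := congrArg Complex.im h1
  simp at hre him
  have hdet : ((g 0 0 : ℝ) * g 1 1 - g 0 1 * g 1 0) = 1 := by exact_mod_cast det_eq g
  set x := z.re
  set y := z.im
  have e1 : (g 0 0 : ℝ) = g 1 1 + 2 * x * g 1 0 := by
    apply mul_right_cancel₀ hz.ne'
    linear_combination him
  have e2 : (g 0 1 : ℝ) = - g 1 0 * (x ^ 2 + y ^ 2) := by
    linear_combination hre - x * e1
  have e3 : ((g 0 0 : ℝ) + g 1 1) ^ 2 + 4 * (g 1 0) ^ 2 * y ^ 2 = 4 := by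
    rw [e1, e2] at hdet
    rw [e1]
    linear_combination 4 * hdet
  have e4 : (g 0 0 + g 1 1) ^ 2 < 36 := by
    have : ((g 0 0 : ℝ) + g 1 1) ^ 2 < 36 := by nlinarith [sq_nonneg (g 1 0 * y : ℝ)]
    exact_mod_cast this
  have e5 : (g 1 0 : ℝ) = 0 := by
    have : ((g 0 0 : ℝ) + g 1 1) ^ 2 = 4 := by
      have : (g 0 0 + g 1 1) ^ 2 = 4 := by rcases trace_cases hg e4 with h | h <;> rw [h] <;> rfl
      exact_mod_cast this
    have : ((g 1 0 : ℝ) * y) ^ 2 = 0 := by linarith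
    simpa [hz.ne'] using this
  have c0 : g 1 0 = 0 := by exact_mod_cast e5
  rw [e5] at e1 e2
  have b0 : g 0 1 = 0 := by
    have : (g 0 1 : ℝ) = 0 := by rw [e2]; ring
    exact_mod_cast this
  have ad : g 0 0 = g 1 1 := by
    have : (g 0 0 : ℝ) = g 1 1 := by rw [e1]; ring
    exact_mod_cast this
  have ht := trace_cases hg e4
  rcases ht with ht | ht
  · left
    have : g 0 0 = 1 := by omega
    ext i j; fin_cases i <;> fin_cases j <;> simp <;> omega
  · right
    ext i j; fin_cases i <;> fin_cases j <;> simp <;> omega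

lemma eq_or_eq_neg_of_smul_eq {g h : SL(2, ℤ)} (hg : g ∈ Gamma 2) (hh : h ∈ Gamma 2) {z : ℍ}
    (e : g • z = h • z) : g = h ∨ g = -h := by
  have : (h⁻¹ * g) • z = z := by rw [mul_smul, e, inv_smul_smul]
  rcases eq_one_or_of_smul_eq (mul_mem (inv_mem hh) hg) this with h' | h'
  · left; rw [inv_mul_eq_iff_eq_mul.1 h', mul_one]
  · right; rw [inv_mul_eq_iff_eq_mul.1 h', mul_neg, mul_one]

/-- A complement of `{1, -1}` in `Γ(2)`. -/
def freeSubgroup : Subgroup SL(2, ℤ) where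
  carrier := {g | g ∈ Gamma 2 ∧ g 0 0 ≡ 1 [ZMOD 4]}
  one_mem' := ⟨one_mem _, by simp⟩
  mul_mem' := by
    rintro g h ⟨hg, ag⟩ ⟨hh, ah⟩
    refine ⟨mul_mem hg hh, ?_⟩
    obtain ⟨-, ⟨b, hb⟩, -, -⟩ := mem_Gamma_two_iff.1 hg
    obtain ⟨-, -, ⟨c, hc⟩, -⟩ := mem_Gamma_two_iff.1 hh
    have : (g * h) 0 0 = g 0 0 * h 0 0 + 4 * (b * c) := by
      rw [SL2_mul_apply, hb, hc]; ring
    rw [this]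
    simpa using (ag.mul ah).add (Int.modEq_zero_iff_dvd.2 (dvd_mul_right 4 (b * c)))
  inv_mem' := by
    rintro g ⟨hg, ag⟩
    refine ⟨inv_mem hg, ?_⟩
    rw [Matrix.SpecialLinearGroup.SL2_inv_expl]
    have h := four_dvd_diag_sub hg
    exact ((Int.modEq_iff_dvd.2 h).trans ag)

lemma exists_mem_freeSubgroup_smul_eq {g : SL(2, ℤ)} (hg : g ∈ Gamma 2) :
    ∃ h ∈ freeSubgroup, ∀ z : ℍ, h • z = g • z := by
  obtain ⟨⟨a, ha⟩, -, -, -⟩ := mem_Gamma_two_iff.1 hg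
  rcases Int.even_or_odd' a with ⟨b, hb | hb⟩
  · exact ⟨g, ⟨hg, Int.modEq_iff_dvd.2 ⟨-b, by omega⟩⟩, fun _ => rfl⟩
  · refine ⟨-g, ⟨neg_mem_Gamma_two hg, Int.modEq_iff_dvd.2 ⟨b + 1, ?_⟩⟩, fun z =>
      ModularGroup.SL_neg_smul g z⟩
    simp [ha, hb]; ring

instance : IsCancelSMul freeSubgroup ℍ where
  right_cancel' := by
    rintro ⟨g, hg, ag⟩ ⟨h, hh, ah⟩ z (e : g • z = h • z)
    rcases eq_or_eq_neg_of_smul_eq hg hh e with rfl | rfl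
    · rfl
    · exfalso
      have := ag.add ah
      simp at this
      exact absurd this (by decide)

instance : ProperlyDiscontinuousSMul freeSubgroup ℍ where
  finite_disjoint_inter_image := by
    intro K L hK hL
    have h : Set.Finite {γ : SL(2, ℤ) | ((γ • ·) '' K ∩ L : Set ℍ).Nonempty} := by
      have h1 := properlyDiscontinuousSL2ZRange.finite_disjoint_inter_image hK hL
      refine Set.Finite.of_finite_image (f := (Matrix.SpecialLinearGroup.mapGL ℝ).rangeRestrict)
        (h1.subset ?_) ?_
      · rintro _ ⟨γ, hγ, rfl⟩
        exact hγ
      · intro γ _ δ _ e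
        have e' : Matrix.SpecialLinearGroup.mapGL ℝ γ = Matrix.SpecialLinearGroup.mapGL ℝ δ :=
          congrArg Subtype.val e
        exact Matrix.SpecialLinearGroup.mapGL_injective e'
    refine Set.Finite.of_finite_image (f := Subtype.val) (h.subset ?_) Subtype.val_injective.injOn
    rintro _ ⟨γ, hγ, rfl⟩
    exact hγ

lemma continuous_SL2Z_smul (g : SL(2, ℤ)) : Continuous fun z : ℍ => g • z :=
  continuous_const_smul (Matrix.SpecialLinearGroup.mapGL ℝ g)

instance : ContinuousConstSMul freeSubgroup ℍ where
  continuous_const_smul g := continuous_SL2Z_smul g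

lemma isCoveringMap_proj : IsCoveringMap proj := by
  have hq : Topology.IsQuotientMap proj := isQuotientMap_quotient_mk'
  refine (hq.isQuotientCoveringMap_of_properlyDiscontinuousSMul (G := freeSubgroup)
    fun {z w} => ?_).isCoveringMap
  rw [proj_eq_iff]
  constructor
  · rintro ⟨g, hg, rfl⟩
    obtain ⟨h, hh, e⟩ := exists_mem_freeSubgroup_smul_eq hg
    exact ⟨⟨h, hh⟩, e w⟩
  · rintro ⟨⟨g, hg⟩, rfl⟩
    exact ⟨g, hg.1, rfl⟩

/-- Two lifts of the same map on a connected space differ by an element of `Γ(2)`. -/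
lemma exists_smul_eq_of_proj_comp_eq {A : Type*} [TopologicalSpace A] [PreconnectedSpace A]
    [Nonempty A] {f₁ f₂ : A → ℍ} (h₁ : Continuous f₁) (h₂ : Continuous f₂)
    (h : ∀ a, proj (f₁ a) = proj (f₂ a)) : ∃ g ∈ Gamma 2, ∀ a, f₁ a = g • f₂ a := by
  obtain ⟨a⟩ := ‹Nonempty A›
  obtain ⟨g, hg, e⟩ := proj_eq_iff.1 (h a)
  refine ⟨g, hg, congrFun (isCoveringMap_proj.eq_of_comp_eq h₁
    ((continuous_SL2Z_smul g).comp h₂) ?_ a e)⟩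
  ext b
  simp only [Function.comp_apply, h b, proj_smul g hg]

section

open Real

/-- The unit-speed parametrization of the imaginary axis. -/
def imAxis (t : ℝ) : ℍ := ⟨⟨0, exp t⟩, exp_pos t⟩

@[simp] lemma imAxis_re (t : ℝ) : (imAxis t).re = 0 := rfl

@[simp] lemma imAxis_im (t : ℝ) : (imAxis t).im = exp t := rfl

lemma det_eq_real (k : SL(2, ℝ)) : k 0 0 * k 1 1 - k 0 1 * k 1 0 = 1 := by
  rw [← Matrix.det_fin_two]; exact k.det_coe

lemma im_smul_real (k : SL(2, ℝ)) (z : ℍ) :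
    (k • z).im * ((k 1 0 * z.re + k 1 1) ^ 2 + (k 1 0 * z.im) ^ 2) = z.im := by
  have hden : ((k 1 0 : ℂ) * z + k 1 1) ≠ 0 := UpperHalfPlane.denom_ne_zero (k : GL (Fin 2) ℝ) z
  have h := UpperHalfPlane.coe_specialLinearGroup_apply k z
  rw [Algebra.algebraMap_self, RingHom.id_apply, RingHom.id_apply, RingHom.id_apply,
    RingHom.id_apply, eq_div_iff hden] at h
  have hre := congrArg Complex.re h
  have him := congrArg Complex.im h
  simp at hre him
  linear_combination z.im * det_eq_real k + (k 1 0 * z.re + k 1 1) * him - k 1 0 * z.im * hre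

lemma re_smul_real (k : SL(2, ℝ)) (z : ℍ) :
    (k • z).re * ((k 1 0 * z.re + k 1 1) ^ 2 + (k 1 0 * z.im) ^ 2) =
      (k 0 0 * z.re + k 0 1) * (k 1 0 * z.re + k 1 1) + k 0 0 * k 1 0 * z.im ^ 2 := by
  have hden : ((k 1 0 : ℂ) * z + k 1 1) ≠ 0 := UpperHalfPlane.denom_ne_zero (k : GL (Fin 2) ℝ) z
  have h := UpperHalfPlane.coe_specialLinearGroup_apply k z
  rw [Algebra.algebraMap_self, RingHom.id_apply, RingHom.id_apply, RingHom.id_apply,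
    RingHom.id_apply, eq_div_iff hden] at h
  have hre := congrArg Complex.re h
  have him := congrArg Complex.im h
  simp at hre him
  linear_combination (k 1 0 * z.re + k 1 1) * hre + k 1 0 * z.im * him

lemma dist_imAxis_sq (z : ℍ) (t : ℝ) :
    z.re ^ 2 + z.im ^ 2 + exp t ^ 2 = 2 * z.im * exp t * cosh (dist z (imAxis t)) := by
  have hz := z.im_pos
  have ht := exp_pos t
  rw [UpperHalfPlane.cosh_dist']
  simp only [imAxis_re, imAxis_im]
  field_simp
  ring

/-- A point is determined by its distances to two points of the imaginary axis, if they agree with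
those of a point of the axis. -/
lemma eq_imAxis_of_dist {z : ℍ} {t : ℝ} (h0 : dist z (imAxis 0) = |t|)
    (h1 : dist z (imAxis 1) = |t - 1|) : z = imAxis t := by
  have e0 := dist_imAxis_sq z 0
  have e1 := dist_imAxis_sq z 1
  rw [h0, cosh_abs, exp_zero, cosh_eq] at e0
  rw [h1, cosh_abs, cosh_eq, neg_sub, exp_sub, exp_sub] at e1
  rw [exp_neg] at e0
  have ht := exp_pos t
  have hE : 1 < exp 1 := by simp
  have hE0 : 0 < exp 1 := exp_pos 1
  field_simp at e0 e1
  have hy : z.im = exp t := by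
    have : (exp 1 ^ 2 - 1) * (exp t - z.im) = 0 := by linear_combination e1 - e0
    rcases mul_eq_zero.1 this with h | h
    · nlinarith
    · linarith
  have hx : z.re = 0 := by
    rw [hy] at e0
    have : z.re ^ 2 * exp t = 0 := by linear_combination e0
    simpa [ht.ne'] using this
  exact UpperHalfPlane.ext_re_im (by simp [hx]) (by simp [hy])

/-- Rotations around `I` act transitively on the circle of radius `1`. -/
lemma exists_rotation {w : ℍ} (hw : dist w (imAxis 0) = 1) :
    ∃ k : SL(2, ℝ), k • imAxis 0 = imAxis 0 ∧ k • imAxis 1 = w := by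
  have hy := w.im_pos
  have hs : 0 < sinh 1 := by simp
  have e0 := dist_imAxis_sq w 0
  rw [hw, exp_zero] at e0
  set X := (cosh 1 - 1 / w.im) / sinh 1 with hX
  set Y := -w.re / (w.im * sinh 1) with hY
  have hcs := cosh_sq 1
  have hXY : X ^ 2 + Y ^ 2 = 1 := by
    rw [hX, hY]; field_simp
    linear_combination e0 + w.im ^ 2 * hcs
  have hn : ‖(⟨X, Y⟩ : ℂ)‖ = 1 := by
    rw [Complex.norm_def, Complex.normSq_mk, ← sq, ← sq, hXY, sqrt_one]
  set φ := Complex.arg ⟨X, Y⟩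
  have hc : cos φ = X := by
    rw [Complex.cos_arg (by rw [← norm_ne_zero_iff, hn]; norm_num), hn]; simp
  have hsn : sin φ = Y := by rw [Complex.sin_arg, hn]; simp
  set c := cos (φ / 2)
  set s := sin (φ / 2)
  have h1 : s ^ 2 + c ^ 2 = 1 := sin_sq_add_cos_sq _
  have h2 : X = 2 * c ^ 2 - 1 := by rw [← hc, ← cos_two_mul]; ring_nf
  have h3 : Y = 2 * s * c := by rw [← hsn, ← sin_two_mul]; ring_nf
  let k : SL(2, ℝ) := ⟨!![c, s; -s, c], by rw [Matrix.det_fin_two]; simp; linarith⟩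
  have k00 : k 0 0 = c := rfl
  have k01 : k 0 1 = s := rfl
  have k10 : k 1 0 = -s := rfl
  have k11 : k 1 1 = c := rfl
  refine ⟨k, UpperHalfPlane.ext_re_im ?_ ?_, UpperHalfPlane.ext_re_im ?_ ?_⟩
  · have := re_smul_real k (imAxis 0)
    simp only [k00, k01, k10, k11, imAxis_re, imAxis_im, exp_zero] at this ⊢
    linear_combination this - (k • imAxis 0).re * h1
  · have := im_smul_real k (imAxis 0)
    simp only [k10, k11, imAxis_re, imAxis_im, exp_zero] at this ⊢
    linear_combination this - (k • imAxis 0).im * h1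
  all_goals
    have hE := exp_pos 1
    have hden : (c ^ 2 + s ^ 2 * exp 1 ^ 2) * w.im = exp 1 := by
      have hc2 : c ^ 2 = (X + 1) / 2 := by linarith
      have hs2 : s ^ 2 = (1 - X) / 2 := by linarith
      have hXs : X * sinh 1 * w.im = cosh 1 * w.im - 1 := by rw [hX]; field_simp
      rw [hc2, hs2]
      rw [sinh_eq, cosh_eq, exp_neg] at hXs
      field_simp at hXs ⊢
      linear_combination -hXs
    have hpos : 0 < c ^ 2 + s ^ 2 * exp 1 ^ 2 := by
      have : 0 < (c ^ 2 + s ^ 2 * exp 1 ^ 2) * w.im := by rw [hden]; exact hE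
      exact pos_of_mul_pos_left this hy.le
  · have := re_smul_real k (imAxis 1)
    simp only [k00, k01, k10, k11, imAxis_re, imAxis_im] at this
    have hYs : Y * (w.im * sinh 1) = - w.re := by rw [hY]; field_simp
    rw [h3, sinh_eq, exp_neg] at hYs
    field_simp at hYs
    apply mul_right_cancel₀ hpos.ne'
    apply mul_right_cancel₀ (mul_pos hy hE).ne'
    linear_combination w.im * exp 1 * this  - exp 1 * w.re * hden - hYs * exp 1
  · have := im_smul_real k (imAxis 1)
    simp only [k10, k11, imAxis_re, imAxis_im] at this
    apply mul_right_cancel₀ hpos.ne'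
    linear_combination this - hden

/-- Every unit-speed geodesic line is the image of the imaginary axis by an element of
`SL(2, ℝ)`. -/
lemma exists_smul_imAxis {ℓ : ℝ → ℍ} (hℓ : Isometry ℓ) :
    ∃ k : SL(2, ℝ), ∀ t, ℓ t = k • imAxis t := by
  obtain ⟨k₁, h₁⟩ := MulAction.exists_smul_eq SL(2, ℝ) (imAxis 0) (ℓ 0)
  have hd : ∀ (k : SL(2, ℝ)) (z w : ℍ), dist (k⁻¹ • z) w = dist z (k • w) := fun k z w => by
    rw [← dist_smul k, smul_inv_smul]
  obtain ⟨k₂, h₂, h₃⟩ := exists_rotation (w := k₁⁻¹ • ℓ 1)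
    (by rw [hd, h₁, hℓ.dist_eq]; simp)
  refine ⟨k₁ * k₂, fun t => ?_⟩
  rw [← inv_smul_eq_iff]
  apply eq_imAxis_of_dist
  · rw [hd, mul_smul, h₂, h₁, hℓ.dist_eq, Real.dist_eq, sub_zero]
  · rw [hd, mul_smul, h₃, smul_inv_smul, hℓ.dist_eq, Real.dist_eq]

lemma eq_one_or_of_smul_imAxis {k : SL(2, ℝ)} (h : ∀ t, k • imAxis t = imAxis t) :
    k = 1 ∨ k = -1 := by
  have hk := det_eq_real k
  have key : ∀ t, k 1 1 ^ 2 + (k 1 0 * exp t) ^ 2 = 1 := fun t => by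
    have := im_smul_real k (imAxis t)
    rw [h t] at this
    simp only [imAxis_re, imAxis_im] at this
    apply mul_left_cancel₀ (exp_pos t).ne'
    linear_combination this
  have k0 := key 0
  have k1 := key 1
  have hE : 1 < exp 1 := by simp
  rw [exp_zero] at k0
  have c0 : k 1 0 = 0 := by
    have : k 1 0 ^ 2 * (exp 1 ^ 2 - 1) = 0 := by linear_combination k1 - k0
    rcases mul_eq_zero.1 this with h | h
    · simpa using h
    · nlinarith
  have b0 : k 0 1 = 0 := by
    have := re_smul_real k (imAxis 0)
    rw [h 0] at this
    simp only [imAxis_re, imAxis_im, c0] at this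
    have h1 : k 0 1 * k 1 1 = 0 := by linear_combination -this
    rcases mul_eq_zero.1 h1 with h | h
    · exact h
    · rw [h, c0] at hk; simp at hk
  rw [c0] at k0 hk
  have d1 : (k 1 1 - 1) * (k 1 1 + 1) = 0 := by linear_combination k0
  rcases mul_eq_zero.1 d1 with d | d
  · left
    have d' : k 1 1 = 1 := by linarith
    have a' : k 0 0 = 1 := by rw [d'] at hk; linarith
    ext i j; fin_cases i <;> fin_cases j <;> simp [*]
  · right
    have d' : k 1 1 = -1 := by linarith
    have a' : k 0 0 = -1 := by rw [d'] at hk; linarith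
    ext i j; fin_cases i <;> fin_cases j <;> simp [*]

/-- `ℓ` is a unit-speed geodesic line of `ℍ`, translated by the length `L` by the element `g` of
`Γ(2)`. -/
structure IsAxis (ℓ : ℝ → ℍ) (L : ℝ) (g : SL(2, ℤ)) : Prop where
  isometry : Isometry ℓ
  pos : 0 < L
  mem : g ∈ CongruenceSubgroup.Gamma 2
  map_add : ∀ t, ℓ (t + L) = g • ℓ t

lemma smul_eq_map_smul (g : SL(2, ℤ)) (z : ℍ) : g • z = (g : SL(2, ℝ)) • z := rfl

lemma isometry_SL2Z_smul (g : SL(2, ℤ)) : Isometry fun z : ℍ => g • z :=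
  isometry_smul ℍ (g : SL(2, ℝ))

lemma IsAxis.conj {ℓ : ℝ → ℍ} {L : ℝ} {g : SL(2, ℤ)} (h : IsAxis ℓ L g) (k : SL(2, ℤ)) :
    IsAxis (fun t => k • ℓ t) L (k * g * k⁻¹) where
  isometry := (isometry_SL2Z_smul k).comp h.isometry
  pos := h.pos
  mem := conj_mem_Gamma_two h.mem k
  map_add t := by rw [h.map_add, mul_smul, mul_smul, inv_smul_smul]

/-- The parameters of an axis: with respect to a suitable `SL(2, ℝ)`-frame `p, q, r, u`. -/
lemma IsAxis.exists_frame {ℓ : ℝ → ℍ} {L : ℝ} {g : SL(2, ℤ)} (h : IsAxis ℓ L g) :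
    ∃ p q r u ε : ℝ, p * u - q * r = 1 ∧ ε ^ 2 = 1 ∧
      (∀ t, (ℓ t).re * (u ^ 2 + r ^ 2 * exp t ^ 2) = q * u + p * r * exp t ^ 2) ∧
      (∀ t, (ℓ t).im * (u ^ 2 + r ^ 2 * exp t ^ 2) = exp t) ∧
      (g 0 0 + g 1 1 : ℝ) = ε * (2 * cosh (L / 2)) ∧
      (g 1 0 : ℝ) = ε * (r * u * (2 * sinh (L / 2))) ∧
      (g 0 1 : ℝ) = - ε * (p * q * (2 * sinh (L / 2))) ∧
      (g 1 1 - g 0 0 : ℝ) = - ε * ((p * u + q * r) * (2 * sinh (L / 2))) := by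
  obtain ⟨k, hk⟩ := exists_smul_imAxis h.isometry
  have hkd := det_eq_real k
  set x := exp (L / 2)
  have hx : 0 < x := exp_pos _
  let D : SL(2, ℝ) := ⟨!![x, 0; 0, x⁻¹], by rw [Matrix.det_fin_two]; simp [hx.ne']⟩
  have hD : ∀ t, D • imAxis t = imAxis (t + L) := fun t => by
    have him := im_smul_real D (imAxis t)
    have hre := re_smul_real D (imAxis t)
    have D0 : D 1 0 = 0 := rfl
    have D1 : D 1 1 = x⁻¹ := rfl
    have D2 : D 0 1 = 0 := rfl
    simp only [D0, D1, D2, imAxis_re, imAxis_im] at him hre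
    field_simp at him hre
    refine UpperHalfPlane.ext_re_im (by simpa using hre) ?_
    have : exp (t + L) = exp t * x ^ 2 := by rw [exp_add, ← exp_nat_mul]; congr 2; push_cast; ring
    simp only [imAxis_im, this]
    linarith
  have hfix : ∀ t, (D⁻¹ * k⁻¹ * (g : SL(2, ℝ)) * k) • imAxis t = imAxis t := fun t => by
    rw [mul_smul, mul_smul, mul_smul, ← hk, ← smul_eq_map_smul, ← h.map_add, hk, inv_smul_smul,
      ← hD, inv_smul_smul]
  have hg : ∃ ε : ℝ, ε ^ 2 = 1 ∧ ∀ i j, (g i j : ℝ) = ε * (k * D * k⁻¹) i j := by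
    have h1 : (g : SL(2, ℝ)) = k * D * (D⁻¹ * k⁻¹ * (g : SL(2, ℝ)) * k) * k⁻¹ := by group
    have h2 : ∀ i j, (g i j : ℝ) = (g : SL(2, ℝ)) i j := fun i j => rfl
    rcases eq_one_or_of_smul_imAxis hfix with e | e
    · rw [e, mul_one] at h1
      exact ⟨1, by norm_num, fun i j => by rw [h2, h1, one_mul]⟩
    · rw [e] at h1
      exact ⟨-1, by norm_num, fun i j => by rw [h2, h1]; simp⟩
  obtain ⟨ε, hε, hg⟩ := hg
  have D00 : D 0 0 = x := rfl
  have D10 : D 1 0 = 0 := rfl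
  have D11 : D 1 1 = x⁻¹ := rfl
  have D01 : D 0 1 = 0 := rfl
  have hc : 2 * cosh (L / 2) = x + x⁻¹ := by rw [cosh_eq, exp_neg]; ring
  have hs : 2 * sinh (L / 2) = x - x⁻¹ := by rw [sinh_eq, exp_neg]; ring
  have g00 := hg 0 0
  have g01 := hg 0 1
  have g10 := hg 1 0
  have g11 := hg 1 1
  simp only [SL2_mul_apply, SL2_inv_zero_zero, SL2_inv_zero_one, SL2_inv_one_zero,
    SL2_inv_one_one, D00, D10, D11, D01] at g00 g01 g10 g11
  refine ⟨k 0 0, k 0 1, k 1 0, k 1 1, ε, by linarith, hε, fun t => ?_, fun t => ?_, ?_, ?_, ?_, ?_⟩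
  · have := re_smul_real k (imAxis t)
    rw [← hk] at this
    simp only [imAxis_re, imAxis_im] at this
    linear_combination this
  · have := im_smul_real k (imAxis t)
    rw [← hk] at this
    simp only [imAxis_re, imAxis_im] at this
    linear_combination this
  · rw [hc]; linear_combination g00 + g11 + ε * (x + x⁻¹) * hkd
  · rw [hs, g10]; ring
  · rw [hs, g01]; ring
  · rw [hs]; linear_combination g11 - g00

end

/-- The parabolic generator of the stabilizer of the cusp `∞` in `Γ(2)`. -/
def parA : SL(2, ℤ) := ⟨!![1, 2; 0, 1], by simp⟩

/-- The parabolic generator of the stabilizer of the cusp `0` in `Γ(2)`. -/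
def parB : SL(2, ℤ) := ⟨!![1, 0; -2, 1], by simp⟩

lemma parA_apply (i j : Fin 2) : parA i j = !![1, 2; 0, 1] i j := rfl

lemma parB_apply (i j : Fin 2) : parB i j = !![1, 0; -2, 1] i j := rfl

lemma S_apply (i j : Fin 2) : S i j = !![0, -1; 1, 0] i j := rfl

lemma T_apply (i j : Fin 2) : T i j = !![1, 1; 0, 1] i j := rfl

lemma parA_mem : parA ∈ Gamma 2 := by rw [mem_Gamma_two_iff]; simp [parA_apply]

lemma parB_mem : parB ∈ Gamma 2 := by rw [mem_Gamma_two_iff]; simp [parB_apply]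

lemma parA_smul (z : ℍ) : parA • z = (2 : ℝ) +ᵥ z := by
  have : parA = T ^ (2 : ℤ) := by
    ext i j; rw [coe_T_zpow]; rfl
  rw [this, UpperHalfPlane.modular_T_zpow_smul]; norm_num

lemma parB_eq : parB = S * parA * S⁻¹ := by
  ext i j
  fin_cases i <;> fin_cases j <;>
    simp [SL2_mul_apply, SL2_inv_zero_zero, SL2_inv_zero_one, SL2_inv_one_zero, SL2_inv_one_one,
      parA_apply, parB_apply, S_apply]

lemma trace_conj (h g : SL(2, ℤ)) :
    (h * g * h⁻¹) 0 0 + (h * g * h⁻¹) 1 1 = g 0 0 + g 1 1 := by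
  have := det_eq h
  simp only [SL2_mul_apply, SL2_inv_zero_zero, SL2_inv_zero_one, SL2_inv_one_zero, SL2_inv_one_one]
  linear_combination (g 0 0 + g 1 1) * this

lemma IsAxis.four_lt_trace_sq {ℓ : ℝ → ℍ} {L : ℝ} {g : SL(2, ℤ)} (h : IsAxis ℓ L g) :
    4 < (g 0 0 + g 1 1) ^ 2 := by
  obtain ⟨p, q, r, u, ε, -, hε, -, -, ht, -⟩ := h.exists_frame
  have : (4 : ℝ) < (g 0 0 + g 1 1 : ℝ) ^ 2 := by
    have hc : 1 < Real.cosh (L / 2) := Real.one_lt_cosh.2 (by linarith [h.pos])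
    rw [ht, mul_pow, hε]; nlinarith
  exact_mod_cast this

lemma IsAxis.thirty_six_le_trace_sq {ℓ : ℝ → ℍ} {L : ℝ} {g : SL(2, ℤ)} (h : IsAxis ℓ L g) :
    36 ≤ (g 0 0 + g 1 1) ^ 2 := by
  by_contra! h'
  have := h.four_lt_trace_sq
  rcases trace_cases h.mem h' with e | e <;> rw [e] at this <;> norm_num at this

/-- An axis of Euclidean width greater than `2` meets its translate by `2`. -/
lemma IsAxis.exists_eq_parA_smul {ℓ : ℝ → ℍ} {L : ℝ} {g : SL(2, ℤ)} (h : IsAxis ℓ L g)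
    (hw : 4 * (g 1 0) ^ 2 < (g 0 0 + g 1 1) ^ 2 - 4) : ∃ s t, ℓ s = parA • ℓ t := by
  obtain ⟨p, q, r, u, ε, hdet, hε, hre, him, ht, hc, -, -⟩ := h.exists_frame
  have hL : 0 < Real.sinh (L / 2) := Real.sinh_pos_iff.2 (by linarith [h.pos])
  have hcs := Real.cosh_sq (L / 2)
  have hw' : 4 * (g 1 0 : ℝ) ^ 2 < (g 0 0 + g 1 1 : ℝ) ^ 2 - 4 := by exact_mod_cast hw
  have hy : (2 * (r * u)) ^ 2 < 1 := by
    rw [ht, hc, mul_pow, mul_pow, hε] at hw'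
    nlinarith [pow_pos hL 2]
  have hc0 : (g 1 0 : ℝ) ≠ 0 := by
    intro h0
    have h0' : g 1 0 = 0 := by exact_mod_cast h0
    have := det_eq g
    rw [h0', mul_zero, sub_zero] at this
    have h4 := h.four_lt_trace_sq
    rcases Int.mul_eq_one_iff_eq_one_or_neg_one.1 this with ⟨h1, h2⟩ | ⟨h1, h2⟩ <;>
      rw [h1, h2] at h4 <;> norm_num at h4
  have hr : r ≠ 0 := by rintro rfl; simp [hc] at hc0
  have hu : u ≠ 0 := by rintro rfl; simp [hc] at hc0
  set y := 2 * (r * u) with hy'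
  obtain ⟨y1, y2⟩ := abs_lt.1 ((sq_lt_one_iff_abs_lt_one y).1 hy)
  set w := (1 + y) / (1 - y) with hw
  have hw0 : 0 < w := div_pos (by linarith) (by linarith)
  have hsw : √w * √w = w := Real.mul_self_sqrt hw0.le
  have hsw0 : 0 < √w := Real.sqrt_pos.2 hw0
  set m := |u / r|
  have hm : m ^ 2 * r ^ 2 = u ^ 2 := by rw [sq_abs]; field_simp
  have hm0 : 0 < m := abs_pos.2 (div_ne_zero hu hr)
  have hyw : w - 1 = y * (w + 1) := by
    have : 1 - y ≠ 0 := by linarith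
    rw [hw]; field_simp; ring
  have e1 := hre (Real.log (m * √w))
  have e2 := him (Real.log (m * √w))
  have e3 := hre (Real.log (m / √w))
  have e4 := him (Real.log (m / √w))
  rw [Real.exp_log (by positivity)] at e1 e2 e3 e4
  have d1 : u ^ 2 + r ^ 2 * (m * √w) ^ 2 = u ^ 2 * (1 + w) := by
    linear_combination w * hm + m ^ 2 * r ^ 2 * hsw
  have d2 : w * (u ^ 2 + r ^ 2 * (m / √w) ^ 2) = u ^ 2 * (1 + w) := by
    have : w * (r ^ 2 * (m / √w) ^ 2) = u ^ 2 := by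
      rw [div_pow, Real.sq_sqrt hw0.le]; field_simp; linarith
    linear_combination this
  have hw1 : 0 < u ^ 2 * (1 + w) := by positivity
  refine ⟨Real.log (m * √w), Real.log (m / √w), ?_⟩
  rw [parA_smul]
  refine UpperHalfPlane.ext_re_im ?_ ?_
  · rw [UpperHalfPlane.vadd_re]
    set R1 := (ℓ (Real.log (m * √w))).re
    set R2 := (ℓ (Real.log (m / √w))).re
    have f1 : R1 * (u ^ 2 * (1 + w)) * r = u * (q * r + p * u * w) := by
      rw [d1] at e1
      rw [e1]; linear_combination p * r ^ 2 * m ^ 2 * hsw + p * w * hm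
    have f2 : R2 * (u ^ 2 * (1 + w)) * r = u * (q * r * w + p * u) := by
      rw [← d2]
      have : w * (p * r ^ 2 * (m / √w) ^ 2) = p * u ^ 2 := by
        rw [div_pow, Real.sq_sqrt hw0.le]; field_simp; linear_combination p * hm
      linear_combination w * r * e3 + this
    apply mul_right_cancel₀ (mul_ne_zero hw1.ne' hr)
    linear_combination f1 - f2 + u * hyw + u * (w - 1) * hdet + u * (w + 1) * hy'
  · rw [UpperHalfPlane.vadd_im]
    rw [d1] at e2
    apply mul_right_cancel₀ hw1.ne'
    rw [e2, ← d2]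
    have : w * (m / √w) = m * √w := by field_simp; linear_combination -hsw
    linear_combination -w * e4 - this

lemma IsAxis.exists_eq_parB_smul {ℓ : ℝ → ℍ} {L : ℝ} {g : SL(2, ℤ)} (h : IsAxis ℓ L g)
    (hw : 4 * (g 0 1) ^ 2 < (g 0 0 + g 1 1) ^ 2 - 4) : ∃ s t, ℓ s = parB • ℓ t := by
  obtain ⟨s, t, e⟩ := (h.conj S⁻¹).exists_eq_parA_smul (by
    rw [trace_conj]
    have : (S⁻¹ * g * S⁻¹⁻¹) 1 0 = - g 0 1 := by
      simp [SL2_mul_apply, SL2_inv_zero_zero, SL2_inv_one_zero, SL2_inv_one_one,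
        S_apply, -inv_inv]
    rw [this]; linarith)
  refine ⟨s, t, ?_⟩
  rw [parB_eq, mul_smul, mul_smul, ← e, smul_inv_smul]

/-- Reduction step for indefinite binary quadratic forms. -/
lemma abs_lt_or_abs_lt_of_disc {b c e : ℤ} (hb : b ≠ 0) (hc : c ≠ 0) (hcb : |c| ≤ |b|)
    (hD : 0 < e ^ 2 + 4 * b * c) (hbD : e ^ 2 + 4 * b * c ≤ 4 * b ^ 2) :
    |b - c + e| < |b| ∨ |b - c - e| < |b| := by
  have same : ∀ B C E : ℤ, 0 < C → C ≤ B → 0 ≤ E → E ^ 2 + 4 * B * C ≤ 4 * B ^ 2 →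
      E < 2 * B - C := fun B C E h1 h2 h3 h4 => by nlinarith
  have opp : ∀ B C E : ℤ, 0 < C → C ≤ B → 0 ≤ E → 0 < E ^ 2 - 4 * B * C →
      E ^ 2 - 4 * B * C ≤ 4 * B ^ 2 → C < E ∧ E < 2 * B + C := fun B C E h1 h2 h3 h4 h5 =>
    ⟨by nlinarith, by nlinarith⟩
  rcases lt_or_gt_of_ne hb with hb | hb <;> rcases lt_or_gt_of_ne hc with hc | hc <;>
  rcases le_total 0 e with he | he <;>
  simp only [abs_of_pos, abs_of_neg, hb, hc] at hcb ⊢ <;> simp only [abs_lt]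
  · have := same (-b) (-c) e (by linarith) (by linarith) he (by linarith)
    left; constructor <;> linarith
  · have := same (-b) (-c) (-e) (by linarith) (by linarith) (by linarith) (by linarith)
    right; constructor <;> linarith
  · have := opp (-b) c e (by linarith) (by linarith) he (by linarith) (by linarith)
    left; constructor <;> linarith
  · have := opp (-b) c (-e) (by linarith) (by linarith) (by linarith) (by linarith) (by linarith)
    right; constructor <;> linarith
  · have := opp b (-c) e (by linarith) (by linarith) he (by linarith) (by linarith)
    right; constructor <;> linarith
  · have := opp b (-c) (-e) (by linarith) (by linarith) (by linarith) (by linarith) (by linarith)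
    left; constructor <;> linarith
  · have := same b c e (by linarith) (by linarith) he (by linarith)
    right; constructor <;> linarith
  · have := same b c (-e) (by linarith) (by linarith) (by linarith) (by linarith)
    left; constructor <;> linarith

/-- Every hyperbolic element is conjugate to one whose axis is wide seen from both `∞` and `0`. -/
lemma exists_conj_reduced (g : SL(2, ℤ)) (hg : 4 < (g 0 0 + g 1 1) ^ 2) :
    ∃ h : SL(2, ℤ), 4 * ((h * g * h⁻¹) 1 0) ^ 2 < (g 0 0 + g 1 1) ^ 2 - 4 ∧
      4 * ((h * g * h⁻¹) 0 1) ^ 2 < (g 0 0 + g 1 1) ^ 2 - 4 := by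
  obtain ⟨n, hn⟩ : ∃ n : ℕ, (g 0 1).natAbs + (g 1 0).natAbs = n := ⟨_, rfl⟩
  induction n using Nat.strong_induction_on generalizing g with
  | _ n ih =>
  have step : ∀ k : SL(2, ℤ), ((k * g * k⁻¹) 0 1).natAbs + ((k * g * k⁻¹) 1 0).natAbs < n →
      ∃ h : SL(2, ℤ), 4 * ((h * g * h⁻¹) 1 0) ^ 2 < (g 0 0 + g 1 1) ^ 2 - 4 ∧
      4 * ((h * g * h⁻¹) 0 1) ^ 2 < (g 0 0 + g 1 1) ^ 2 - 4 := fun k hk => by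
    obtain ⟨h, h1, h2⟩ := ih _ hk (k * g * k⁻¹) (by rwa [trace_conj]) rfl
    rw [trace_conj] at h1 h2
    have e : h * (k * g * k⁻¹) * h⁻¹ = h * k * g * (h * k)⁻¹ := by group
    rw [e] at h1 h2
    exact ⟨h * k, h1, h2⟩
  by_cases h0 : 4 * (g 1 0) ^ 2 < (g 0 0 + g 1 1) ^ 2 - 4 ∧ 4 * (g 0 1) ^ 2 < (g 0 0 + g 1 1) ^ 2 - 4
  · exact ⟨1, by simpa using h0⟩
  have hdet := det_eq g
  have hbc : g 0 1 * g 1 0 ≠ 0 := fun h => by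
    rw [h, sub_zero] at hdet
    rcases Int.mul_eq_one_iff_eq_one_or_neg_one.1 hdet with ⟨h1, h2⟩ | ⟨h1, h2⟩ <;>
      rw [h1, h2] at hg <;> norm_num at hg
  have hb : g 0 1 ≠ 0 := left_ne_zero_of_mul hbc
  have hc : g 1 0 ≠ 0 := right_ne_zero_of_mul hbc
  have hD : (g 1 1 - g 0 0) ^ 2 + 4 * g 0 1 * g 1 0 = (g 0 0 + g 1 1) ^ 2 - 4 := by
    linear_combination -4 * hdet
  rcases le_total |g 1 0| |g 0 1| with hle | hle
  · have hbD : (g 1 1 - g 0 0) ^ 2 + 4 * g 0 1 * g 1 0 ≤ 4 * (g 0 1) ^ 2 := by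
      rw [hD]
      by_contra! h
      exact h0 ⟨lt_of_le_of_lt (by linarith [sq_le_sq.2 hle]) h, h⟩
    rcases abs_lt_or_abs_lt_of_disc hb hc hle (by rw [hD]; linarith) hbD with hlt | hlt
    · refine step T ?_
      have e1 : (T * g * T⁻¹) 0 1 = g 0 1 - g 1 0 + (g 1 1 - g 0 0) := by
        simp [SL2_mul_apply, SL2_inv_zero_one, SL2_inv_one_one, T_apply]; ring
      have e2 : (T * g * T⁻¹) 1 0 = g 1 0 := by
        simp [SL2_mul_apply, SL2_inv_zero_zero, SL2_inv_one_zero, T_apply]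
      rw [e1, e2, ← hn]; rw [Int.abs_eq_natAbs, Int.abs_eq_natAbs] at hlt; omega
    · refine step T⁻¹ ?_
      have e1 : (T⁻¹ * g * T⁻¹⁻¹) 0 1 = g 0 1 - g 1 0 - (g 1 1 - g 0 0) := by
        simp [SL2_mul_apply, SL2_inv_zero_zero, SL2_inv_zero_one,
          T_apply]; ring
      have e2 : (T⁻¹ * g * T⁻¹⁻¹) 1 0 = g 1 0 := by
        simp [SL2_mul_apply, SL2_inv_one_one,
          SL2_inv_one_zero, T_apply]
      rw [e1, e2, ← hn]; rw [Int.abs_eq_natAbs, Int.abs_eq_natAbs] at hlt; omega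
  · have hbD : (g 1 1 - g 0 0) ^ 2 + 4 * g 1 0 * g 0 1 ≤ 4 * (g 1 0) ^ 2 := by
      have : (g 1 1 - g 0 0) ^ 2 + 4 * g 1 0 * g 0 1 = (g 0 0 + g 1 1) ^ 2 - 4 := by rw [← hD]; ring
      rw [this]
      by_contra! h
      exact h0 ⟨h, lt_of_le_of_lt (by linarith [sq_le_sq.2 hle]) h⟩
    rcases abs_lt_or_abs_lt_of_disc hc hb hle
      (by linarith [mul_right_comm 4 (g 1 0) (g 0 1)]) hbD with hlt | hlt
    · refine step (T * S) ?_
      have e1 : (T * S * g * (T * S)⁻¹) 0 1 = -(g 1 0 - g 0 1 + (g 1 1 - g 0 0)) := by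
        simp [SL2_mul_apply, SL2_inv_zero_one, SL2_inv_one_one, T_apply, S_apply]; ring
      have e2 : (T * S * g * (T * S)⁻¹) 1 0 = - g 0 1 := by
        simp [SL2_mul_apply, SL2_inv_zero_zero, SL2_inv_one_zero, T_apply, S_apply]
      rw [e1, e2, ← hn]; rw [Int.abs_eq_natAbs, Int.abs_eq_natAbs] at hlt; omega
    · refine step (T⁻¹ * S) ?_
      have e1 : (T⁻¹ * S * g * (T⁻¹ * S)⁻¹) 0 1 = -(g 1 0 - g 0 1 - (g 1 1 - g 0 0)) := by
        simp [SL2_mul_apply, SL2_inv_zero_zero, SL2_inv_zero_one, SL2_inv_one_one,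
          SL2_inv_one_zero, T_apply, S_apply]; ring
      have e2 : (T⁻¹ * S * g * (T⁻¹ * S)⁻¹) 1 0 = - g 0 1 := by
        simp [SL2_mul_apply, SL2_inv_zero_zero, SL2_inv_zero_one, SL2_inv_one_one,
          SL2_inv_one_zero, T_apply, S_apply]
      rw [e1, e2, ← hn]; rw [Int.abs_eq_natAbs, Int.abs_eq_natAbs] at hlt; omega

/-- The self-intersections modulo `L` of the projection of a line `ℓ`. -/
def crossings (ℓ : ℝ → ℍ) (L : ℝ) : Set (ℝ × ℝ) :=
  {p | 0 ≤ p.1 ∧ p.1 < p.2 ∧ p.2 < L ∧ proj (ℓ p.1) = proj (ℓ p.2)}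

lemma crossings_smul (ℓ : ℝ → ℍ) (L : ℝ) (k : SL(2, ℤ)) :
    crossings (fun t => k • ℓ t) L = crossings ℓ L := by
  ext p; simp only [crossings, Set.mem_ofPred_eq, proj_smul_eq_iff]

namespace IsAxis

variable {ℓ : ℝ → ℍ} {L : ℝ} {g : SL(2, ℤ)}

lemma map_add_int_mul (h : IsAxis ℓ L g) (n : ℤ) : ∀ t, ℓ (t + n * L) = g ^ n • ℓ t := by
  induction n with
  | zero => simp
  | succ n ih =>
    intro t
    rw [zpow_add_one, mul_smul, ← h.map_add, ← ih]
    congr 1; push_cast; ring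
  | pred n ih =>
    intro t
    have := h.map_add (t - L)
    rw [sub_add_cancel] at this
    rw [zpow_sub_one, mul_smul, this, inv_smul_smul, ← ih]
    congr 1; push_cast; ring

lemma proj_add_int_mul (h : IsAxis ℓ L g) (n : ℤ) (t : ℝ) : proj (ℓ (t + n * L)) = proj (ℓ t) := by
  rw [h.map_add_int_mul, proj_smul _ (zpow_mem h.mem n)]

lemma zpow (h : IsAxis ℓ L g) {n : ℤ} (hn : 0 < n) : IsAxis ℓ (n * L) (g ^ n) where
  isometry := h.isometry
  pos := mul_pos (by exact_mod_cast hn) h.pos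
  mem := zpow_mem h.mem n
  map_add := h.map_add_int_mul n

lemma trace_sq_eq (h : IsAxis ℓ L g) : (g 0 0 + g 1 1 : ℝ) ^ 2 = 4 * Real.cosh (L / 2) ^ 2 := by
  obtain ⟨p, q, r, u, ε, -, hε, -, -, ht, -⟩ := h.exists_frame
  rw [ht, mul_pow, hε]; ring

lemma trace_sq_le_zpow (h : IsAxis ℓ L g) {n : ℤ} (hn : n ≠ 0) :
    (g 0 0 + g 1 1) ^ 2 ≤ ((g ^ n) 0 0 + (g ^ n) 1 1) ^ 2 := by
  wlog hp : 0 < n generalizing n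
  · have := this (neg_ne_zero.2 hn) (by omega)
    rw [zpow_neg, SL2_inv_zero_zero, SL2_inv_one_one] at this
    linarith
  have e1 := h.trace_sq_eq
  have e2 := (h.zpow hp).trace_sq_eq
  have h1 : (1 : ℝ) ≤ n := by exact_mod_cast hp
  have : Real.cosh (L / 2) ≤ Real.cosh (n * L / 2) := by
    rw [Real.cosh_le_cosh, abs_of_pos (by linarith [h.pos]),
      abs_of_pos (by nlinarith [h.pos])]
    nlinarith [h.pos]
  have h2 : (g 0 0 + g 1 1 : ℝ) ^ 2 ≤ ((g ^ n) 0 0 + (g ^ n) 1 1 : ℝ) ^ 2 := by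
    rw [e1, e2]
    have := Real.cosh_pos (L / 2)
    gcongr
  exact_mod_cast h2

/-- Two points of the axis related by a parabolic element are not related by the translation. -/
lemma ne_add_int_mul_of_parabolic (h : IsAxis ℓ L g) {k : SL(2, ℤ)} (hk : k ∈ Gamma 2)
    (hk1 : k ≠ 1) (hk2 : k 0 0 + k 1 1 = 2) {s t : ℝ} (e : ℓ s = k • ℓ t) (n : ℤ) :
    s ≠ t + n * L := by
  rintro rfl
  rw [h.map_add_int_mul] at e
  have h36 := h.thirty_six_le_trace_sq
  rcases eq_or_ne n 0 with rfl | hn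
  · rcases eq_or_eq_neg_of_smul_eq (one_mem _) hk (by simpa using e) with e' | e'
    · exact hk1 e'.symm
    · have : k = -1 := by rw [e', neg_neg]
      rw [this] at hk2; simp at hk2
  · have := h.trace_sq_le_zpow hn
    rcases eq_or_eq_neg_of_smul_eq (zpow_mem h.mem n) hk e with e' | e' <;> rw [e'] at this
    · rw [hk2] at this; linarith
    · simp only [Matrix.SpecialLinearGroup.coe_neg, Matrix.neg_apply] at this
      have e4 : -k 0 0 + -k 1 1 = -2 := by linarith
      rw [e4] at this; linarith

lemma exists_mem_crossings (h : IsAxis ℓ L g) {s t : ℝ} (e : proj (ℓ s) = proj (ℓ t))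
    (hne : ∀ n : ℤ, s ≠ t + n * L) :
    ∃ m n : ℤ, (s + m * L, t + n * L) ∈ crossings ℓ L ∨ (t + n * L, s + m * L) ∈ crossings ℓ L := by
  have key : ∀ x : ℝ, ∃ m : ℤ, 0 ≤ x + m * L ∧ x + m * L < L := fun x => by
    refine ⟨-⌊x / L⌋, ?_, ?_⟩
    · have := mul_le_mul_of_nonneg_right (Int.floor_le (x / L)) h.pos.le
      rw [div_mul_cancel₀ _ h.pos.ne'] at this
      push_cast; linarith
    · have := mul_lt_mul_of_pos_right (Int.lt_floor_add_one (x / L)) h.pos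
      rw [div_mul_cancel₀ _ h.pos.ne'] at this
      push_cast; linarith
  obtain ⟨m, m1, m2⟩ := key s
  obtain ⟨n, n1, n2⟩ := key t
  refine ⟨m, n, ?_⟩
  rcases lt_trichotomy (s + m * L) (t + n * L) with hlt | heq | hlt
  · exact Or.inl ⟨m1, hlt, n2, by rw [h.proj_add_int_mul, h.proj_add_int_mul, e]⟩
  · exact absurd (by push_cast; linarith) (hne (n - m))
  · exact Or.inr ⟨n1, hlt, m2, by rw [h.proj_add_int_mul, h.proj_add_int_mul, e]⟩

lemma congr_of_subsingleton (h : IsAxis ℓ L g) (hc : (crossings ℓ L).Subsingleton) {s t s' t' : ℝ}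
    (e : proj (ℓ s) = proj (ℓ t)) (hne : ∀ n : ℤ, s ≠ t + n * L)
    (e' : proj (ℓ s') = proj (ℓ t')) (hne' : ∀ n : ℤ, s' ≠ t' + n * L) :
    ∃ m n : ℤ, (s' = s + m * L ∧ t' = t + n * L) ∨ (s' = t + m * L ∧ t' = s + n * L) := by
  obtain ⟨m, n, hmn⟩ := h.exists_mem_crossings e hne
  obtain ⟨m', n', hmn'⟩ := h.exists_mem_crossings e' hne'
  rcases hmn with hmn | hmn <;> rcases hmn' with hmn' | hmn' <;>
    obtain ⟨h1, h2⟩ := Prod.mk_inj.1 (hc hmn hmn')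
  · exact ⟨m - m', n - n', Or.inl ⟨by push_cast; linarith, by push_cast; linarith⟩⟩
  · exact ⟨n - m', m - n', Or.inr ⟨by push_cast; linarith, by push_cast; linarith⟩⟩
  · exact ⟨n - m', m - n', Or.inr ⟨by push_cast; linarith, by push_cast; linarith⟩⟩
  · exact ⟨m - m', n - n', Or.inl ⟨by push_cast; linarith, by push_cast; linarith⟩⟩

end IsAxis

lemma sq_eq_one_of_odd_of_dvd_two {a : ℤ} (ha : Odd a) (h : a ∣ 2) : a ^ 2 = 1 := by
  have h1 := Int.le_of_dvd (by norm_num) h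
  have h2 := Int.le_of_dvd (by norm_num) (neg_dvd.2 h)
  obtain ⟨k, rfl⟩ := ha
  have : k = 0 ∨ k = -1 := by omega
  rcases this with rfl | rfl <;> norm_num

lemma trace_eq_six_of_commute {G : SL(2, ℤ)} (hG : G ∈ Gamma 2)
    (hc : Commute (G * parA⁻¹ * G⁻¹ * parB) G) :
    (G * parA⁻¹ * G⁻¹ * parB) 0 0 + (G * parA⁻¹ * G⁻¹ * parB) 1 1 = 6 ∧
      (G * parA⁻¹ * G⁻¹ * parB) 0 1 ≠ 0 := by
  obtain ⟨ha, -, -, -⟩ := mem_Gamma_two_iff.1 hG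
  have hdet := det_eq G
  set M := G * parA⁻¹ * G⁻¹ * parB with hM
  have M00 : M 0 0 = 1 + 2 * G 0 0 * G 1 0 + 4 * G 0 0 ^ 2 := by
    simp [hM, SL2_mul_apply, SL2_inv_zero_zero, SL2_inv_zero_one, SL2_inv_one_zero,
      SL2_inv_one_one, parA_apply, parB_apply, -mul_inv_rev]
    linear_combination hdet
  have M01 : M 0 1 = -2 * G 0 0 ^ 2 := by
    simp [hM, SL2_mul_apply, SL2_inv_zero_zero, SL2_inv_zero_one, SL2_inv_one_zero,
      SL2_inv_one_one, parA_apply, parB_apply, -mul_inv_rev]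
    ring
  have M11 : M 1 1 = 1 - 2 * G 0 0 * G 1 0 := by
    simp [hM, SL2_mul_apply, SL2_inv_zero_zero, SL2_inv_zero_one, SL2_inv_one_zero,
      SL2_inv_one_one, parA_apply, parB_apply, -mul_inv_rev]
    linear_combination hdet
  have e : (M * G) 0 1 = (G * M) 0 1 := by rw [hc.eq]
  rw [SL2_mul_apply M G, SL2_mul_apply G M, M00, M01, M11] at e
  have ha0 : G 0 0 ≠ 0 := by rintro h; rw [h] at ha; exact absurd ha (by decide)
  have e' : 2 * G 0 1 * (G 1 0 + G 0 0) = - G 0 0 * (G 0 0 - G 1 1) := by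
    apply mul_left_cancel₀ (mul_ne_zero two_ne_zero ha0)
    linear_combination e
  have hdvd : G 0 0 ∣ 2 := ⟨2 * G 1 1 + 2 * G 0 1 + G 0 0 - G 1 1,
    by linear_combination -e' - 2 * hdet⟩
  have hsq := sq_eq_one_of_odd_of_dvd_two ha hdvd
  refine ⟨by rw [M00, M11]; linear_combination 4 * hsq, by rw [M01, hsq]; norm_num⟩

lemma trace_eq_neg_two_of_commute {G : SL(2, ℤ)} (hG : G ∈ Gamma 2)
    (hc : Commute (parB * (G * parA * G⁻¹)) G) :
    (parB * (G * parA * G⁻¹)) 0 0 + (parB * (G * parA * G⁻¹)) 1 1 = -2 ∧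
      (parB * (G * parA * G⁻¹)) 0 1 ≠ 0 := by
  obtain ⟨ha, -, -, -⟩ := mem_Gamma_two_iff.1 hG
  have hdet := det_eq G
  set M := parB * (G * parA * G⁻¹) with hM
  have M00 : M 0 0 = 1 - 2 * G 0 0 * G 1 0 := by
    simp [hM, SL2_mul_apply, SL2_inv_zero_zero, SL2_inv_one_zero,
      parA_apply, parB_apply]
    linear_combination hdet
  have M01 : M 0 1 = 2 * G 0 0 ^ 2 := by
    simp [hM, SL2_mul_apply, SL2_inv_zero_one,
      SL2_inv_one_one, parA_apply, parB_apply]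
    ring
  have M11 : M 1 1 = 1 + 2 * G 0 0 * G 1 0 - 4 * G 0 0 ^ 2 := by
    simp [hM, SL2_mul_apply, SL2_inv_zero_one,
      SL2_inv_one_one, parA_apply, parB_apply]
    linear_combination hdet
  have e : (M * G) 0 1 = (G * M) 0 1 := by rw [hc.eq]
  rw [SL2_mul_apply M G, SL2_mul_apply G M, M00, M01, M11] at e
  have ha0 : G 0 0 ≠ 0 := by rintro h; rw [h] at ha; exact absurd ha (by decide)
  have e' : 2 * G 0 1 * (G 0 0 - G 1 0) = G 0 0 * (G 0 0 - G 1 1) := by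
    apply mul_left_cancel₀ (mul_ne_zero two_ne_zero ha0)
    linear_combination e
  have hdvd : G 0 0 ∣ 2 := ⟨2 * G 1 1 - 2 * G 0 1 + G 0 0 - G 1 1,
    by linear_combination e' - 2 * hdet⟩
  have hsq := sq_eq_one_of_odd_of_dvd_two ha hdvd
  refine ⟨by rw [M00, M11]; linear_combination -4 * hsq, by rw [M01, hsq]; norm_num⟩

namespace IsAxis

variable {ℓ : ℝ → ℍ} {L : ℝ} {g : SL(2, ℤ)}

lemma parA_ne_one : parA ≠ 1 := fun h => by
  have := congrArg (fun m : SL(2, ℤ) => m 0 1) h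
  simp [parA_apply] at this

lemma parB_ne_one : parB ≠ 1 := fun h => by
  have := congrArg (fun m : SL(2, ℤ) => m 1 0) h
  simp [parB_apply] at this

lemma trace_sq_eq_of_subsingleton_of_reduced (h : IsAxis ℓ L g)
    (hA : 4 * (g 1 0) ^ 2 < (g 0 0 + g 1 1) ^ 2 - 4)
    (hB : 4 * (g 0 1) ^ 2 < (g 0 0 + g 1 1) ^ 2 - 4) (hc : (crossings ℓ L).Subsingleton) :
    (g 0 0 + g 1 1) ^ 2 = 36 := by
  have h36 := h.thirty_six_le_trace_sq
  obtain ⟨s, t, e⟩ := h.exists_eq_parA_smul hA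
  obtain ⟨s', t', e'⟩ := h.exists_eq_parB_smul hB
  have sq_of : ∀ {M : SL(2, ℤ)} {j : ℤ}, M 0 1 ≠ 0 → (M = g ^ j ∨ M = -g ^ j) →
      (g 0 0 + g 1 1) ^ 2 ≤ (M 0 0 + M 1 1) ^ 2 := fun {M j} hM hj => by
    have hj0 : j ≠ 0 := by
      rintro rfl
      rcases hj with hj | hj <;> rw [hj] at hM <;> simp at hM
    have := h.trace_sq_le_zpow hj0
    rcases hj with hj | hj <;> rw [hj]
    · exact this
    · simp only [Matrix.SpecialLinearGroup.coe_neg, Matrix.neg_apply]; linarith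
  have comm : ∀ {M : SL(2, ℤ)} {j : ℤ}, (M = g ^ j ∨ M = -g ^ j) → ∀ n : ℤ, Commute M (g ^ n) := by
    rintro M j (rfl | rfl) n
    · exact Commute.zpow_zpow_self g j n
    · exact (Commute.zpow_zpow_self g j n).neg_left
  obtain ⟨m, n, ⟨hs, ht⟩ | ⟨hs, ht⟩⟩ := h.congr_of_subsingleton hc
    (by rw [e, proj_smul _ parA_mem])
    (h.ne_add_int_mul_of_parabolic parA_mem parA_ne_one (by simp [parA_apply]) e)
    (by rw [e', proj_smul _ parB_mem])
    (h.ne_add_int_mul_of_parabolic parB_mem parB_ne_one (by simp [parB_apply]) e')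
  · rw [hs, ht, h.map_add_int_mul, h.map_add_int_mul, e, ← mul_smul, ← mul_smul] at e'
    have hm : (g ^ m * parA⁻¹ * (g ^ m)⁻¹ * parB) = g ^ (m - n) ∨
        (g ^ m * parA⁻¹ * (g ^ m)⁻¹ * parB) = -g ^ (m - n) := by
      rcases eq_or_eq_neg_of_smul_eq (mul_mem (zpow_mem h.mem m) parA_mem)
        (mul_mem parB_mem (zpow_mem h.mem n)) e' with e1 | e1
      · left
        rw [← eq_mul_inv_iff_mul_eq] at e1
        rw [zpow_sub]
        have : parB = g ^ m * parA * (g ^ n)⁻¹ := by rw [e1]; group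
        rw [this]; group
      · right
        have : parB = -(g ^ m * parA * (g ^ n)⁻¹) := by rw [e1]; simp
        rw [this, zpow_sub, mul_neg]; congr 1; group
    obtain ⟨t1, t2⟩ := trace_eq_six_of_commute (zpow_mem h.mem m) (comm hm m)
    have := sq_of t2 hm
    rw [t1] at this; linarith
  · rw [hs, ht, h.map_add_int_mul, h.map_add_int_mul, e, ← mul_smul, ← mul_smul] at e'
    have hm : (parB * (g ^ n * parA * (g ^ n)⁻¹)) = g ^ (m - n) ∨
        (parB * (g ^ n * parA * (g ^ n)⁻¹)) = -g ^ (m - n) := by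
      rcases eq_or_eq_neg_of_smul_eq (zpow_mem h.mem m)
        (mul_mem (mul_mem parB_mem (zpow_mem h.mem n)) parA_mem) e' with e1 | e1
      · left
        rw [zpow_sub, e1]; group
      · right
        rw [zpow_sub, e1, neg_mul, neg_neg]; group
    obtain ⟨t1, t2⟩ := trace_eq_neg_two_of_commute (zpow_mem h.mem n) (comm hm n)
    have := sq_of t2 hm
    rw [t1] at this; linarith

/-- A closed geodesic with at most one self-intersection has trace `± 6`. -/
lemma trace_sq_eq_of_subsingleton (h : IsAxis ℓ L g) (hc : (crossings ℓ L).Subsingleton) :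
    (g 0 0 + g 1 1) ^ 2 = 36 := by
  obtain ⟨k, hA, hB⟩ := exists_conj_reduced g h.four_lt_trace_sq
  rw [← trace_conj k] at hA hB ⊢
  exact (h.conj k).trace_sq_eq_of_subsingleton_of_reduced hA hB (by rwa [crossings_smul])

lemma crossings_nonempty (h : IsAxis ℓ L g) : (crossings ℓ L).Nonempty := by
  obtain ⟨k, hA, -⟩ := exists_conj_reduced g h.four_lt_trace_sq
  rw [← trace_conj k] at hA
  rw [← crossings_smul ℓ L k]
  have h' := h.conj k
  obtain ⟨s, t, e⟩ := h'.exists_eq_parA_smul hA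
  obtain ⟨m, n, hmn⟩ := h'.exists_mem_crossings (by rw [e, proj_smul _ parA_mem])
    (h'.ne_add_int_mul_of_parabolic parA_mem parA_ne_one (by simp [parA_apply]) e)
  rcases hmn with hmn | hmn <;> exact ⟨_, hmn⟩

end IsAxis

/-- Elements of `Γ(2)` of trace `± 6` are, up to conjugacy in `SL(2, ℤ)`, one of eight matrices. -/
lemma exists_conj_of_trace_sq {g : SL(2, ℤ)} (hg : g ∈ Gamma 2) (ht : (g 0 0 + g 1 1) ^ 2 = 36) :
    ∃ k : SL(2, ℤ), (k * g * k⁻¹) 0 1 = (k * g * k⁻¹) 1 0 ∧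
      ((k * g * k⁻¹) 1 0 = 2 ∨ (k * g * k⁻¹) 1 0 = -2) ∧
      ((k * g * k⁻¹) 1 1 - (k * g * k⁻¹) 0 0 = 4 ∨ (k * g * k⁻¹) 1 1 - (k * g * k⁻¹) 0 0 = -4) := by
  obtain ⟨k, hA, hB⟩ := exists_conj_reduced g (by rw [ht]; norm_num)
  refine ⟨k, ?_⟩
  have hdet := det_eq (k * g * k⁻¹)
  have htr := trace_conj k g
  obtain ⟨-, ⟨b, hb⟩, ⟨c, hc⟩, -⟩ := mem_Gamma_two_iff.1 (conj_mem_Gamma_two hg k)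
  rw [ht] at hA hB
  rw [hb, hc] at hdet ⊢
  rw [hc] at hA
  rw [hb] at hB
  have hD : ((k * g * k⁻¹) 1 1 - (k * g * k⁻¹) 0 0) ^ 2 + 4 * (b + b) * (c + c) = 32 := by
    linear_combination ht - 4 * hdet +
      ((k * g * k⁻¹) 0 0 + (k * g * k⁻¹) 1 1 + g 0 0 + g 1 1) * htr
  set e := (k * g * k⁻¹) 1 1 - (k * g * k⁻¹) 0 0
  have hc1 : c < 2 := by nlinarith
  have hc2 : -2 < c := by nlinarith
  have hb1 : b < 2 := by nlinarith
  have hb2 : -2 < b := by nlinarith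
  have he : e < 9 := by nlinarith
  have he' : -9 < e := by nlinarith
  clear_value e
  clear hA hB hdet
  have : b = c ∧ (c = 1 ∨ c = -1) ∧ (e = 4 ∨ e = -4) := by
    interval_cases b <;> interval_cases c <;> simp at hD ⊢ <;>
      (try (interval_cases e <;> omega))
  obtain ⟨rfl, h2, h3⟩ := this
  exact ⟨rfl, by omega, h3⟩

lemma exists_conj_axis_sqrt_two {g : SL(2, ℤ)} (hg : g ∈ Gamma 2)
    (ht : (g 0 0 + g 1 1) ^ 2 = 36) :
    ∃ k : SL(2, ℤ), ((k * g * k⁻¹) 1 0) ^ 2 = 4 ∧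
      (k * g * k⁻¹) 0 1 = 2 * (k * g * k⁻¹) 1 0 ∧ (k * g * k⁻¹) 1 1 = (k * g * k⁻¹) 0 0 := by
  obtain ⟨k, h1, h2, h3⟩ := exists_conj_of_trace_sq hg ht
  set m := k * g * k⁻¹ with hm
  have : m 1 1 - m 0 0 = 2 * m 1 0 ∨ m 1 1 - m 0 0 = -2 * m 1 0 := by omega
  have hsq : (m 1 0) ^ 2 = 4 := by rcases h2 with h | h <;> rw [h] <;> rfl
  rcases this with h | h
  · refine ⟨T * k, ?_⟩
    have e : T * k * g * (T * k)⁻¹ = T * m * T⁻¹ := by rw [hm]; group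
    rw [e]
    simp [SL2_mul_apply, SL2_inv_zero_zero, SL2_inv_zero_one, SL2_inv_one_zero, SL2_inv_one_one,
      T_apply, hsq]
    constructor <;> linarith
  · refine ⟨T⁻¹ * k, ?_⟩
    have e : T⁻¹ * k * g * (T⁻¹ * k)⁻¹ = T⁻¹ * m * T⁻¹⁻¹ := by rw [hm]; group
    rw [e]
    simp [SL2_mul_apply, SL2_inv_zero_zero, SL2_inv_zero_one, SL2_inv_one_zero, SL2_inv_one_one,
      T_apply, hsq, -inv_inv]
    constructor <;> linarith

/-- The parametrization of the half circle of radius `√2` around `0`. -/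
lemma IsAxis.exists_center {ℓ : ℝ → ℍ} {L : ℝ} {g : SL(2, ℤ)} (h : IsAxis ℓ L g)
    (ht : (g 0 0 + g 1 1) ^ 2 = 36) (hc : (g 1 0) ^ 2 = 4) (hb : g 0 1 = 2 * g 1 0)
    (ha : g 1 1 = g 0 0) :
    Real.cosh (L / 2) = 3 ∧ (∀ t, (ℓ t).re ^ 2 + (ℓ t).im ^ 2 = 2) ∧
      ∃ s₀, ∀ t, (ℓ t).im ^ 2 * Real.cosh (t - s₀) ^ 2 = 2 := by
  have hC := h.trace_sq_eq
  have ht' : (g 0 0 + g 1 1 : ℝ) ^ 2 = 36 := by exact_mod_cast ht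
  have hcosh : Real.cosh (L / 2) = 3 := by
    have := Real.cosh_pos (L / 2)
    nlinarith
  obtain ⟨p, q, r, u, ε, hdet, hε, hre, him, -, gc, gb, ge⟩ := h.exists_frame
  have hS := Real.cosh_sq (L / 2)
  set S := Real.sinh (L / 2)
  have hS0 : 0 < S := Real.sinh_pos_iff.2 (by linarith [h.pos])
  rw [hcosh] at hS
  have hε0 : ε ≠ 0 := by rintro rfl; norm_num at hε
  have hc' : (g 1 0 : ℝ) ^ 2 = 4 := by exact_mod_cast hc
  have hb' : (g 0 1 : ℝ) = 2 * g 1 0 := by exact_mod_cast hb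
  rw [ha, sub_self] at ge
  have hsum : p * u + q * r = 0 := by
    have : ε * S * (p * u + q * r) = 0 := by linear_combination ge / 2
    simpa [hε0, hS0.ne'] using this
  have hpu : p * u = 1 / 2 := by linarith
  have hqr : q * r = -1 / 2 := by linarith
  have hru : 8 * (r * u) ^ 2 = 1 := by
    rw [gc] at hc'
    linear_combination hc' / 4 - (r * u) ^ 2 * S ^ 2 * hε + (r * u) ^ 2 * hS
  have hq : q ^ 2 * u ^ 2 = 2 * u ^ 4 := by
    linear_combination (-q ^ 2 * u ^ 2) * hru + 8 * u ^ 4 * (q * r - 1 / 2) * hqr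
  have hp : p ^ 2 * r ^ 2 = 2 * r ^ 4 := by
    linear_combination (-p ^ 2 * r ^ 2) * hru + 8 * r ^ 4 * (p * u + 1 / 2) * hpu
  have hr : r ≠ 0 := by rintro rfl; norm_num at hru
  have hu : u ≠ 0 := by rintro rfl; norm_num at hru
  refine ⟨hcosh, fun t => ?_, Real.log |u / r|, fun t => ?_⟩
  · have h1 := hre t
    have h2 := him t
    have hX := Real.exp_pos t
    set X := Real.exp t
    have hpos : 0 < u ^ 2 + r ^ 2 * X ^ 2 := by positivity
    apply mul_right_cancel₀ (pow_pos hpos 2).ne'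
    linear_combination ((ℓ t).re * (u ^ 2 + r ^ 2 * X ^ 2) + (q * u + p * r * X ^ 2)) * h1 +
      ((ℓ t).im * (u ^ 2 + r ^ 2 * X ^ 2) + X) * h2 + hq + X ^ 4 * hp + 2 * X ^ 2 * p * u * hqr
      - X ^ 2 * hpu - X ^ 2 / 2 * hru
  · have h2 := him t
    have hX := Real.exp_pos t
    have hm : 0 < |u / r| := abs_pos.2 (div_ne_zero hu hr)
    have hm2 : |u / r| ^ 2 * r ^ 2 = u ^ 2 := by rw [sq_abs]; field_simp
    rw [Real.cosh_eq, neg_sub, Real.exp_sub, Real.exp_sub, Real.exp_log hm]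
    set X := Real.exp t
    set m := |u / r|
    have hpos : 0 < u ^ 2 + r ^ 2 * X ^ 2 := by positivity
    have e1 : (X / m + m / X) / 2 * (2 * X * m * r ^ 2) = u ^ 2 + r ^ 2 * X ^ 2 := by
      field_simp; linear_combination hm2
    have e2 : (ℓ t).im * ((X / m + m / X) / 2) * (2 * m * r ^ 2) = 1 := by
      apply mul_right_cancel₀ hX.ne'
      linear_combination (ℓ t).im * e1 + h2
    have e3 : 2 * (2 * m * r ^ 2) ^ 2 = 1 := by linear_combination 8 * r ^ 2 * hm2 + hru
    have e4 : 0 < (2 * m * r ^ 2) ^ 2 := by positivity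
    apply mul_right_cancel₀ e4.ne'
    linear_combination ((ℓ t).im * ((X / m + m / X) / 2) * (2 * m * r ^ 2) + 1) * e2 - e3

lemma im_smul_int (k : SL(2, ℤ)) (z : ℍ) :
    (k • z).im * ((k 1 0 * z.re + k 1 1) ^ 2 + (k 1 0 * z.im) ^ 2) = z.im :=
  im_smul_real (k : SL(2, ℝ)) z

lemma re_smul_int (k : SL(2, ℤ)) (z : ℍ) :
    (k • z).re * ((k 1 0 * z.re + k 1 1) ^ 2 + (k 1 0 * z.im) ^ 2) =
      (k 0 0 * z.re + k 0 1) * (k 1 0 * z.re + k 1 1) + k 0 0 * k 1 0 * z.im ^ 2 :=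
  re_smul_real (k : SL(2, ℝ)) z

lemma normSq_smul_int (k : SL(2, ℤ)) (z : ℍ) :
    ((k • z).re ^ 2 + (k • z).im ^ 2) * ((k 1 0 * z.re + k 1 1) ^ 2 + (k 1 0 * z.im) ^ 2) =
      (k 0 0 * z.re + k 0 1) ^ 2 + (k 0 0 * z.im) ^ 2 := by
  have h1 := im_smul_int k z
  have h2 := re_smul_int k z
  have hdet : (k 0 0 * k 1 1 - k 0 1 * k 1 0 : ℝ) = 1 := by exact_mod_cast det_eq k
  have hz := z.im_pos
  set N := (k 1 0 * z.re + k 1 1 : ℝ) ^ 2 + (k 1 0 * z.im) ^ 2 with hN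
  have hN0 : N ≠ 0 := by
    intro h0; rw [h0, mul_zero] at h1; exact hz.ne h1
  apply mul_right_cancel₀ hN0
  set R := (k • z).re
  set J := (k • z).im
  have : ((k 0 0 * z.re + k 0 1 : ℝ) * (k 1 0 * z.re + k 1 1) + k 0 0 * k 1 0 * z.im ^ 2) ^ 2 +
      z.im ^ 2 = ((k 0 0 * z.re + k 0 1) ^ 2 + (k 0 0 * z.im) ^ 2) * N := by
    rw [hN]
    linear_combination (-z.im ^ 2) * (k 0 0 * k 1 1 - k 0 1 * k 1 0 + 1 : ℝ) * hdet
  rw [← this]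
  linear_combination (R * N + ((k 0 0 * z.re + k 0 1) * (k 1 0 * z.re + k 1 1) +
    k 0 0 * k 1 0 * z.im ^ 2)) * h2 + (J * N + z.im) * h1

/-- Arithmetic of the intersection points of the half circle of radius `√2` with its translates
by `Γ(2)`. -/
lemma exists_of_smul_mem_circle {k : SL(2, ℤ)} (hk : k ∈ Gamma 2) {z : ℍ}
    (hz : z.re ^ 2 + z.im ^ 2 = 2) (hkz : (k • z).re ^ 2 + (k • z).im ^ 2 = 2) :
    (∃ a β : ℤ, a ^ 2 + 1 = 2 * β ^ 2 ∧ z.im ^ 2 * β ^ 2 = 1) ∨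
      (k 0 0 = k 1 1 ∧ k 0 1 = 2 * k 1 0 ∧ k 0 0 ^ 2 = 1 + 2 * k 1 0 ^ 2) := by
  obtain ⟨⟨a', ha⟩, ⟨b, hb⟩, ⟨c, hc⟩, ⟨d', hd⟩⟩ := mem_Gamma_two_iff.1 hk
  have hdet := det_eq k
  have hn := normSq_smul_int k z
  rw [hkz] at hn
  set a := k 0 0
  set d := k 1 1
  -- the transformed form `A x² + 4 β x y + 2 C y²`
  set A := a ^ 2 - 8 * c ^ 2 with hA
  set C := 2 * b ^ 2 - d ^ 2 with hC
  set β := a * b - 2 * c * d with hβ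
  have hdisc : 2 * β ^ 2 = 1 + A * C := by
    rw [hb, hc] at hdet
    rw [hβ, hA, hC]
    linear_combination (a * d - 4 * b * c + 1) * hdet
  have hlin : (A + C + 2 * β * z.re : ℝ) = 0 := by
    rw [hb, hc] at hn
    rw [hA, hC, hβ]
    push_cast at hn ⊢
    linear_combination (-hn / 2) - (a ^ 2 - 8 * c ^ 2) / 2 * hz
  have hz0 := z.im_pos
  have hbound : (A + C) ^ 2 ≤ 8 * β ^ 2 ∧ ((A + C) ^ 2 = 8 * β ^ 2 → β = 0) := by
    have h1 : ((A + C : ℤ) : ℝ) ^ 2 + 4 * β ^ 2 * z.im ^ 2 = 8 * β ^ 2 := by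
      push_cast
      linear_combination (A + C - 2 * β * z.re : ℝ) * hlin + 4 * β ^ 2 * hz
    constructor
    · have : ((A + C : ℤ) : ℝ) ^ 2 ≤ 8 * β ^ 2 := by
        have : 0 ≤ (4 * β ^ 2 * z.im ^ 2 : ℝ) := by positivity
        linarith
      exact_mod_cast this
    · intro h
      have h' : ((A + C : ℤ) : ℝ) ^ 2 = 8 * β ^ 2 := by exact_mod_cast h
      have : (4 * β ^ 2 * z.im ^ 2 : ℝ) = 0 := by linarith
      simpa [hz0.ne'] using this
  obtain ⟨hb1, hb2⟩ := hbound
  have hA4 : ∃ A', A = 4 * A' + 1 := ⟨a' ^ 2 + a' - 2 * c ^ 2, by rw [hA, ha]; ring⟩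
  have hCo : ∃ C', C = 2 * C' + 1 := ⟨b ^ 2 - 2 * d' ^ 2 - 2 * d' - 1, by rw [hC, hd]; ring⟩
  obtain ⟨A', hA'⟩ := hA4
  obtain ⟨C', hC'⟩ := hCo
  have hdiff : (A - C) ^ 2 ≤ 4 := by linarith
  have hlo : -2 ≤ A - C := by nlinarith
  have hhi : A - C ≤ 2 := by nlinarith
  have hcases : A - C = 0 ∨ A - C = 2 ∨ A - C = -2 := by omega
  rcases hcases with h0 | h2
  · left
    have hAC : C = A := by linarith
    rw [hAC] at hdisc hlin
    refine ⟨A, β, by linarith, ?_⟩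
    have hd' : (2 * β ^ 2 : ℝ) = 1 + A * A := by exact_mod_cast hdisc
    linear_combination (β ^ 2 : ℝ) * hz + hd' - (β * z.re - A : ℝ) / 2 * hlin
  · right
    have h4 : (A - C) ^ 2 = 4 := by rcases h2 with h | h <;> rw [h] <;> rfl
    have hβ0 : β = 0 := hb2 (by linarith)
    rw [hβ0] at hdisc
    have hAC : A * C = -1 := by linarith
    have hA1 : A = 1 := by
      have hu : IsUnit A := .of_mul_eq_one (-C) (by linarith)
      rcases Int.isUnit_iff.1 hu with h | h <;> omega
    have hC1 : C = -1 := by rw [hA1] at hAC; linarith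
    rw [hβ] at hβ0
    rw [hA] at hA1
    rw [hC] at hC1
    rw [hb, hc] at hdet ⊢
    have ead : a = d := by linear_combination a * hC1 + d * hdet - 2 * b * hβ0
    have ebc : b = 2 * c := by linear_combination (-b) * hA1 + 2 * c * hdet + a * hβ0
    exact ⟨ead, by linarith, by linear_combination hA1⟩

lemma cosh_dist_eq_of_smul_mem_circle {k : SL(2, ℤ)} {z : ℍ} (hz : z.re ^ 2 + z.im ^ 2 = 2)
    (hkz : (k • z).re ^ 2 + (k • z).im ^ 2 = 2) (h1 : k 0 0 = k 1 1) (h2 : k 0 1 = 2 * k 1 0)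
    (h3 : k 0 0 ^ 2 = 1 + 2 * k 1 0 ^ 2) :
    Real.cosh (dist (k • z) z) = 1 + 4 * k 1 0 ^ 2 := by
  have e1 := im_smul_int k z
  have e2 := re_smul_int k z
  have h3' : (k 0 0 ^ 2 : ℝ) = 1 + 2 * k 1 0 ^ 2 := by exact_mod_cast h3
  have hy := z.im_pos
  have hy' := (k • z).im_pos
  rw [← h1] at e1 e2
  rw [h2] at e2
  push_cast at e2
  rw [UpperHalfPlane.cosh_dist']
  set c : ℝ := ((k 1 0 : ℤ) : ℝ)
  set a : ℝ := ((k 0 0 : ℤ) : ℝ)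
  set R := (k • z).re
  set J := (k • z).im
  set x := z.re
  set y := z.im
  set N := (c * x + a) ^ 2 + (c * y) ^ 2
  have hN : N = 1 + 4 * c ^ 2 + 2 * a * c * x := by linear_combination c ^ 2 * hz + h3'
  have hN0 : N ≠ 0 := by intro h0; rw [h0, mul_zero] at e1; exact hy.ne e1
  rw [div_eq_iff (by positivity)]
  apply mul_right_cancel₀ hN0
  have e3 : R * N = 4 * a * c + (1 + 4 * c ^ 2) * x := by
    linear_combination e2 + a * c * hz + x * h3'
  linear_combination (N * (hz + hkz)) - 2 * x * e3 - 2 * y * (1 + 4 * c ^ 2) * e1 + 4 * hN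
    - 2 * (1 + 4 * c ^ 2) * hz

lemma eq_one_of_sq_add_one {a β : ℤ} (h : a ^ 2 + 1 = 2 * β ^ 2) (hβ : 2 * β ^ 2 ≤ 9) :
    β ^ 2 = 1 := by
  have h1 : a < 3 := by nlinarith
  have h2 : -3 < a := by nlinarith
  have h3 : β < 3 := by nlinarith
  have h4 : -3 < β := by nlinarith
  interval_cases a <;> interval_cases β <;> omega

namespace IsAxis

variable {ℓ : ℝ → ℍ} {L : ℝ} {g : SL(2, ℤ)}

lemma exists_abs_add_int_mul_le (h : IsAxis ℓ L g) (x : ℝ) : ∃ m : ℤ, |x + m * L| ≤ L / 2 := by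
  refine ⟨-round (x / L), ?_⟩
  have := abs_sub_round (x / L)
  have h' := mul_le_mul_of_nonneg_right this h.pos.le
  rw [← abs_of_pos h.pos, ← abs_mul, abs_of_pos h.pos, sub_mul, div_mul_cancel₀ _ h.pos.ne'] at h'
  push_cast
  rw [neg_mul, ← sub_eq_add_neg]; linarith

lemma exists_abs_eq_of_crossing (h : IsAxis ℓ L g) (hC : Real.cosh (L / 2) = 3)
    (hcirc : ∀ t, (ℓ t).re ^ 2 + (ℓ t).im ^ 2 = 2) {s₀ : ℝ}
    (him : ∀ t, (ℓ t).im ^ 2 * Real.cosh (t - s₀) ^ 2 = 2) {s t : ℝ}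
    (e : proj (ℓ s) = proj (ℓ t)) (hne : ∀ n : ℤ, s ≠ t + n * L) :
    ∃ m : ℤ, |s + m * L - s₀| = Real.arcosh √2 := by
  obtain ⟨n, hn⟩ := h.exists_abs_add_int_mul_le (t - s)
  obtain ⟨m, hm⟩ := h.exists_abs_add_int_mul_le (s - s₀)
  set z := ℓ (s + m * L)
  obtain ⟨k, hk, hkz⟩ : ∃ k ∈ Gamma 2, ℓ (t + (n + m : ℤ) * L) = k • z := by
    rw [← proj_eq_iff, h.proj_add_int_mul, h.proj_add_int_mul, e]
  refine ⟨m, ?_⟩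
  rw [show s + m * L - s₀ = s - s₀ + m * L by ring]
  have hx := him (s + m * L)
  rw [show s + m * L - s₀ = s - s₀ + m * L by ring] at hx
  set x := s - s₀ + m * L
  have hcx : Real.cosh x ≤ 3 := by
    rw [← hC, Real.cosh_le_cosh, abs_of_pos (half_pos h.pos)]; exact hm
  have hcirc' : (k • z).re ^ 2 + (k • z).im ^ 2 = 2 := by rw [← hkz]; exact hcirc _
  have hc2 : Real.cosh x ^ 2 = 2 := by
    rcases exists_of_smul_mem_circle hk (hcirc _) hcirc' with ⟨a, β, h1, h2⟩ | ⟨h1, h2, h3⟩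
    · have h4 : Real.cosh x ^ 2 = 2 * β ^ 2 := by
        linear_combination (-Real.cosh x ^ 2) * h2 + (β ^ 2 : ℝ) * hx
      have h5 : (2 * β ^ 2 : ℝ) ≤ 9 := by rw [← h4]; nlinarith [Real.cosh_pos x]
      have h6 := eq_one_of_sq_add_one h1 (by exact_mod_cast h5)
      have h7 : (β ^ 2 : ℝ) = 1 := by exact_mod_cast h6
      rw [h4, h7, mul_one]
    · exfalso
      have h4 := cosh_dist_eq_of_smul_mem_circle (hcirc _) hcirc' h1 h2 h3
      rw [← hkz, h.isometry.dist_eq, Real.dist_eq, Real.cosh_abs] at h4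
      have h5 : t + (n + m : ℤ) * L - (s + m * L) = t - s + n * L := by push_cast; ring
      rw [h5] at h4
      have h6 : Real.cosh (t - s + n * L) ≤ 3 := by
        rw [← hC, Real.cosh_le_cosh, abs_of_pos (half_pos h.pos)]; exact hn
      have h7 : (4 * k 1 0 ^ 2 : ℝ) ≤ 2 := by linarith
      have h8 : 4 * k 1 0 ^ 2 ≤ 2 := by exact_mod_cast h7
      have h9 : k 1 0 = 0 := by nlinarith
      rw [h9] at h4
      have h10 := Real.one_lt_cosh (x := t - s + n * L)
      have h11 : t - s + n * L = 0 := by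
        by_contra h0
        have := h10.2 h0
        rw [h4] at this; norm_num at this
      exact hne n (by linarith)
  have hc3 : Real.cosh |x| = √2 := by
    rw [Real.cosh_abs, ← hc2, Real.sqrt_sq (Real.cosh_pos x).le]
  rw [← hc3, Real.arcosh_cosh (abs_nonneg x)]

lemma eq_of_eq_add_int_mul (h : IsAxis ℓ L g) {x y : ℝ} (hx0 : 0 ≤ x) (hxL : x < L) (hy0 : 0 ≤ y)
    (hyL : y < L) {m n : ℤ} (e : x + m * L = y + n * L) : x = y := by
  have h1 : x - y = (n - m : ℤ) * L := by push_cast; linarith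
  have h2 : (n - m : ℤ) < (1 : ℝ) := by
    by_contra! h3
    nlinarith [h.pos]
  have h3 : (-1 : ℝ) < (n - m : ℤ) := by
    by_contra! h3
    nlinarith [h.pos]
  have h4 : n - m < 1 := by exact_mod_cast h2
  have h5 : -1 < n - m := by exact_mod_cast h3
  have h6 : n - m = 0 := by omega
  rw [h6] at h1
  push_cast at h1
  linarith

lemma crossings_subsingleton_of_circle (h : IsAxis ℓ L g) (hC : Real.cosh (L / 2) = 3)
    (hcirc : ∀ t, (ℓ t).re ^ 2 + (ℓ t).im ^ 2 = 2) {s₀ : ℝ}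
    (him : ∀ t, (ℓ t).im ^ 2 * Real.cosh (t - s₀) ^ 2 = 2) : (crossings ℓ L).Subsingleton := by
  have key : ∀ p ∈ crossings ℓ L, (∃ m : ℤ, |p.1 + m * L - s₀| = Real.arcosh √2) ∧
      ∃ m : ℤ, |p.2 + m * L - s₀| = Real.arcosh √2 := by
    rintro ⟨s, t⟩ ⟨h0, hlt, hL, e⟩
    have hne : ∀ n : ℤ, s ≠ t + n * L := fun n e => hlt.ne
      (h.eq_of_eq_add_int_mul (m := 0) (n := n) h0 (hlt.trans hL) (h0.trans hlt.le) hL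
        (by push_cast; linarith))
    have hne' : ∀ n : ℤ, t ≠ s + n * L := fun n e => hne (-n) (by push_cast; linarith)
    exact ⟨h.exists_abs_eq_of_crossing hC hcirc him e hne,
      h.exists_abs_eq_of_crossing hC hcirc him e.symm hne'⟩
  have eq_of : ∀ {x y : ℝ} {m n : ℤ}, 0 ≤ x → x < L → 0 ≤ y → y < L →
      x + m * L - s₀ = y + n * L - s₀ → x = y := fun {x y m n} h1 h2 h3 h4 h5 =>
    h.eq_of_eq_add_int_mul (m := m) (n := n) h1 h2 h3 h4 (by linarith)
  rintro ⟨s, t⟩ hp ⟨s', t'⟩ hp'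
  obtain ⟨⟨m₁, h₁⟩, m₂, h₂⟩ := key _ hp
  obtain ⟨⟨m₃, h₃⟩, m₄, h₄⟩ := key _ hp'
  obtain ⟨a1, a2, a3, -⟩ := hp
  obtain ⟨b1, b2, b3, -⟩ := hp'
  simp only at h₁ h₂ h₃ h₄ a1 a2 a3 b1 b2 b3
  have a4 := a2.trans a3
  have a5 := a1.trans a2.le
  have b4 := b2.trans b3
  have b5 := b1.trans b2.le
  have e12 : s + m₁ * L - s₀ = -(t + m₂ * L - s₀) := by
    rcases abs_eq_abs.1 (h₁.trans h₂.symm) with e | e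
    · exact absurd (eq_of a1 a4 a5 a3 e) a2.ne
    · exact e
  have e34 : s' + m₃ * L - s₀ = -(t' + m₄ * L - s₀) := by
    rcases abs_eq_abs.1 (h₃.trans h₄.symm) with e | e
    · exact absurd (eq_of b1 b4 b5 b3 e) b2.ne
    · exact e
  rcases abs_eq_abs.1 (h₁.trans h₃.symm) with e | e
  · rw [eq_of a1 a4 b1 b4 e, eq_of a5 a3 b5 b3 (m := m₂) (n := m₄) (by linarith)]
  · have e1 := eq_of a1 a4 b5 b3 (m := m₁) (n := m₄) (by linarith)
    have e2 := eq_of a5 a3 b1 b4 (m := m₂) (n := m₃) (by linarith)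
    linarith

/-- A closed geodesic of trace `± 6` has at most one self-intersection. -/
lemma crossings_subsingleton (h : IsAxis ℓ L g) (ht : (g 0 0 + g 1 1) ^ 2 = 36) :
    (crossings ℓ L).Subsingleton := by
  obtain ⟨k, hc, hb, ha⟩ := exists_conj_axis_sqrt_two h.mem ht
  rw [← trace_conj k] at ht
  obtain ⟨hC, hcirc, s₀, him⟩ := (h.conj k).exists_center ht hc hb ha
  rw [← crossings_smul ℓ L k]
  exact (h.conj k).crossings_subsingleton_of_circle hC hcirc him

end IsAxis

/-- The loop `p` lifts to a path in `ℍ` from `w` to `g • w`. -/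
def HasLift {y : Y} (p : Path y y) (w : ℍ) (g : SL(2, ℤ)) : Prop :=
  ∃ P : Path w (g • w), ∀ t, p t = proj (P t)

namespace HasLift

variable {y y' : Y} {p q : Path y y} {w : ℍ} {g k : SL(2, ℤ)}

lemma neg (h : HasLift p w g) : HasLift p w (-g) := by
  obtain ⟨P, hP⟩ := h
  exact ⟨P.cast rfl (SL_neg_smul g w), hP⟩

lemma smul (h : HasLift p w g) (hk : k ∈ Gamma 2) : HasLift p (k • w) (k * g * k⁻¹) := by
  obtain ⟨P, hP⟩ := h
  refine ⟨(P.map (continuous_SL2Z_smul k)).cast rfl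
    (by rw [mul_smul, mul_smul, inv_smul_smul]), fun t => ?_⟩
  change _ = proj (k • P t)
  rw [hP, proj_smul k hk]

lemma trans (hp : HasLift p w g) (hq : HasLift q w k) (hg : g ∈ Gamma 2) :
    HasLift (p.trans q) w (g * k) := by
  obtain ⟨P, hP⟩ := hp
  obtain ⟨Q, hQ⟩ := hq
  refine ⟨P.trans ((Q.map (continuous_SL2Z_smul g)).cast rfl (mul_smul g k w)), fun t => ?_⟩
  rw [Path.trans_apply, Path.trans_apply]
  split_ifs
  · rw [hP]
  · change _ = proj (g • Q _)
    rw [hQ, proj_smul g hg]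

lemma symm (hp : HasLift p w g) (hg : g ∈ Gamma 2) : HasLift p.symm w g⁻¹ := by
  obtain ⟨P, hP⟩ := hp
  refine ⟨(P.symm.map (continuous_SL2Z_smul g⁻¹)).cast (inv_smul_smul g w).symm rfl, fun t => ?_⟩
  change p _ = proj (g⁻¹ • P _)
  rw [hP, proj_smul _ (inv_mem hg)]

lemma exists_lift (p : Path y y) (hw : proj w = y) : ∃ g ∈ Gamma 2, HasLift p w g := by
  obtain ⟨P, hP, hP0⟩ := isCoveringMap_proj.exists_path_lifts (p : C(I, Y)) w (by simp [hw])
  have hP' : ∀ t, p t = proj (P t) := fun t => (congrFun hP t).symm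
  obtain ⟨g, hg, e⟩ := proj_eq_iff.1 (show proj (P 1) = proj w by rw [← hP', p.target, hw])
  exact ⟨g, hg, ⟨P, hP0, e⟩, hP'⟩

lemma smul_eq_of_homotopic_refl (hp : HasLift p w g) (h : p.Homotopic (Path.refl y)) :
    g • w = w := by
  obtain ⟨P, hP⟩ := hp
  have hw : y = proj w := by rw [← p.source, hP, P.source]
  have e := isCoveringMap_proj.liftPath_apply_one_eq_of_homotopicRel h w
    (by simp [hw]) (by simp [hw])
  have e1 : (P : C(I, ℍ)) = isCoveringMap_proj.liftPath (p : C(I, Y)) w (by simp [hw]) :=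
    (isCoveringMap_proj.eq_liftPath_iff' _).2 ⟨funext fun t => (hP t).symm, P.source⟩
  have e2 : ContinuousMap.const I w =
      isCoveringMap_proj.liftPath ((Path.refl y : Path y y) : C(I, Y)) w (by simp [hw]) :=
    (isCoveringMap_proj.eq_liftPath_iff' _).2 ⟨funext fun t => by simp [hw], rfl⟩
  have e3 := (DFunLike.congr_fun e1 1).trans (e.trans (DFunLike.congr_fun e2 1).symm)
  exact P.target.symm.trans e3

lemma homotopic_refl (hp : HasLift p w g) (h : g • w = w) : p.Homotopic (Path.refl y) := by
  obtain ⟨P, hP⟩ := hp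
  have hw : y = proj w := by rw [← p.source, hP, P.source]
  subst hw
  have h1 : (P.cast rfl h.symm).Homotopic (Path.refl w) := SimplyConnectedSpace.paths_homotopic _ _
  have h2 := h1.map ⟨proj, continuous_proj⟩
  have h3 : p = (P.cast rfl h.symm).map continuous_proj := Path.ext (funext hP)
  rw [h3]
  exact h2

end HasLift

/-- The Coons patch with the given boundary values. -/
def coons (a b c d : I → ℝ) (s t : I) : ℝ :=
  (1 - s) * a t + s * b t + (1 - t) * c s + t * d s -
    ((1 - s) * (1 - t) * a 0 + (1 - s) * t * a 1 + s * (1 - t) * b 0 + s * t * b 1)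

section coons

variable {a b c d : I → ℝ} {s t : I}

lemma coons_zero_left (h0 : c 0 = a 0) (h1 : d 0 = a 1) : coons a b c d 0 t = a t := by
  simp only [coons, h0, h1, Set.Icc.coe_zero]; ring

lemma coons_one_left (h0 : c 1 = b 0) (h1 : d 1 = b 1) : coons a b c d 1 t = b t := by
  simp only [coons, h0, h1, Set.Icc.coe_one]; ring

lemma coons_zero_right : coons a b c d s 0 = c s := by simp only [coons, Set.Icc.coe_zero]; ring

lemma coons_one_right : coons a b c d s 1 = d s := by simp only [coons, Set.Icc.coe_one]; ring

end coons

/-- Free homotopy classes of loops in `Y` are conjugacy classes of deck transformations. -/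
lemma freelyHomotopic_of_hasLift {x y : Y} {p : Path x x} {q : Path y y} {w w' : ℍ}
    {g : SL(2, ℤ)} (hg : g ∈ Gamma 2) (hp : HasLift p w g) (hq : HasLift q w' g) :
    FreelyHomotopic p q := by
  obtain ⟨P, hP⟩ := hp
  obtain ⟨Q, hQ⟩ := hq
  obtain ⟨r⟩ := PathConnectedSpace.joined w w'
  let F : I × I → ℍ := fun z =>
    ⟨⟨coons (fun t => (P t).re) (fun t => (Q t).re) (fun s => (r s).re) (fun s => (g • r s).re)
        z.1 z.2,
      Real.exp (coons (fun t => Real.log (P t).im) (fun t => Real.log (Q t).im)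
        (fun s => Real.log (r s).im) (fun s => Real.log (g • r s).im) z.1 z.2)⟩, Real.exp_pos _⟩
  have hgr : Continuous fun s => g • r s := (continuous_SL2Z_smul g).comp r.continuous
  have hre : ∀ {f : I → ℍ}, Continuous f → Continuous fun t => (f t).re := fun hf =>
    UpperHalfPlane.continuous_re.comp hf
  have him : ∀ {f : I → ℍ}, Continuous f → Continuous fun t => Real.log (f t).im := fun hf =>
    (UpperHalfPlane.continuous_im.comp hf).log fun t => (UpperHalfPlane.im_pos _).ne'
  have hco : ∀ {a b c d : I → ℝ}, Continuous a → Continuous b → Continuous c → Continuous d →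
      Continuous fun z : I × I => coons a b c d z.1 z.2 := fun ha hb hc hd => by
    unfold coons; fun_prop
  have hF : Continuous F := by
    refine Continuous.upperHalfPlaneMk ?_ _
    have h1 := hco (hre P.continuous) (hre Q.continuous) (hre r.continuous) (hre hgr)
    have h2 := hco (him P.continuous) (him Q.continuous) (him r.continuous) (him hgr)
    exact Complex.equivRealProdCLM.symm.continuous.comp (h1.prodMk (Real.continuous_exp.comp h2))
  have ext_of : ∀ (s t : I) (z : ℍ), coons (fun t => (P t).re) (fun t => (Q t).re)
      (fun s => (r s).re) (fun s => (g • r s).re) s t = z.re →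
      coons (fun t => Real.log (P t).im) (fun t => Real.log (Q t).im)
        (fun s => Real.log (r s).im) (fun s => Real.log (g • r s).im) s t = Real.log z.im →
      F (s, t) = z := fun s t z h1 h2 => by
    refine UpperHalfPlane.ext_re_im h1 ?_
    change Real.exp _ = _
    rw [h2, Real.exp_log z.im_pos]
  refine ⟨⟨fun z => proj (F z), continuous_proj.comp hF⟩, fun t => ?_, fun t => ?_, fun s => ?_⟩
  · change proj (F (0, t)) = _
    rw [hP, ext_of 0 t (P t)] <;> rw [coons_zero_left] <;> simp only [r.source, P.source, P.target]
  · change proj (F (1, t)) = _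
    rw [hQ, ext_of 1 t (Q t)] <;> rw [coons_one_left] <;> simp only [r.target, Q.source, Q.target]
  · change proj (F (s, 0)) = proj (F (s, 1))
    rw [ext_of s 0 (r s) coons_zero_right coons_zero_right,
      ext_of s 1 (g • r s) coons_one_right coons_one_right, proj_smul g hg]

lemma freelyHomotopic_of_conj {x y : Y} {p : Path x x} {q : Path y y} {w w' : ℍ}
    {g g' k : SL(2, ℤ)} (hp : HasLift p w g) (hq : HasLift q w' g') (hg' : g' ∈ Gamma 2)
    (hk : k ∈ Gamma 2) (h : g = k * g' * k⁻¹ ∨ g = -(k * g' * k⁻¹)) : FreelyHomotopic p q := by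
  refine freelyHomotopic_of_hasLift (conj_mem_Gamma_two hg' k) (w := w) ?_ (hq.smul hk)
  rcases h with rfl | rfl
  · exact hp
  · simpa using hp.neg

lemma exists_conj_of_freelyHomotopic {x y : Y} {p : Path x x} {q : Path y y} {w w' : ℍ}
    {g g' : SL(2, ℤ)} (hg : g ∈ Gamma 2) (hg' : g' ∈ Gamma 2) (hp : HasLift p w g)
    (hq : HasLift q w' g') (h : FreelyHomotopic p q) :
    ∃ k ∈ Gamma 2, g = k * g' * k⁻¹ ∨ g = -(k * g' * k⁻¹) := by
  obtain ⟨P, hP⟩ := hp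
  obtain ⟨Q, hQ⟩ := hq
  obtain ⟨H, H0, H1, Hs⟩ := h
  have e0 : ∀ t, H (0, t) = proj ((P : C(I, ℍ)) t) := fun t => by rw [H0, hP]; rfl
  set F := isCoveringMap_proj.liftHomotopy H (P : C(I, ℍ)) e0
  have hF : ∀ z, proj (F z) = H z := congrFun (isCoveringMap_proj.liftHomotopy_lifts H _ e0)
  have hF0 : ∀ t, F (0, t) = P t := isCoveringMap_proj.liftHomotopy_zero H _ e0
  have hF1 : ∀ s, F (s, 1) = g • F (s, 0) := by
    refine congrFun (isCoveringMap_proj.eq_of_comp_eq (f := proj) (g₁ := fun s => F (s, 1))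
      (g₂ := fun s => g • F (s, 0)) (by fun_prop)
      ((continuous_SL2Z_smul g).comp (by fun_prop)) ?_ 0 ?_)
    · ext s; simp only [Function.comp_apply, proj_smul g hg, hF, Hs]
    · change F (0, 1) = g • F (0, 0)
      rw [hF0, hF0, P.target, P.source]
  obtain ⟨k, hk, e⟩ := exists_smul_eq_of_proj_comp_eq (f₁ := fun t => F (1, t)) (f₂ := Q)
    (by fun_prop) Q.continuous (fun t => by rw [hF, H1, hQ])
  refine ⟨k, hk, eq_or_eq_neg_of_smul_eq hg (conj_mem_Gamma_two hg' k) (z := k • w') ?_⟩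
  have h1 := e 1
  have h0 := e 0
  simp only [Q.source, Q.target] at h0 h1
  rw [mul_smul, mul_smul, inv_smul_smul, ← h1, ← h0, hF1]

/-- The deck transformation of the `i`-th horocycle. -/
def periph (i : Fin 3) : SL(2, ℤ) := cuspMap i * parA * (cuspMap i)⁻¹

lemma periph_mem (i : Fin 3) : periph i ∈ Gamma 2 := conj_mem_Gamma_two parA_mem _

lemma hasLift_horocycle (i : Fin 3) :
    HasLift (horocycle i) (cuspMap i • (⟨2 * Complex.I, by simp⟩ : ℍ)) (periph i) := by
  set z : ℍ := ⟨2 * Complex.I, by simp⟩ with hz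
  let P : Path z (parA • z) :=
    { toFun := fun t => (2 * (t : ℝ)) +ᵥ z
      continuous_toFun := by
        rw [UpperHalfPlane.isEmbedding_coe.continuous_iff]
        simp only [Function.comp_def, UpperHalfPlane.coe_vadd]
        fun_prop
      source' := by simp
      target' := by rw [parA_smul, Set.Icc.coe_one, mul_one] }
  exact ⟨(P.map (continuous_SL2Z_smul (cuspMap i))).cast rfl
    (by rw [periph, mul_smul, mul_smul, inv_smul_smul]), fun t => rfl⟩

lemma cuspMap_zero : cuspMap 0 = 1 := rfl

lemma cuspMap_one : cuspMap 1 = S := rfl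

lemma cuspMap_two : cuspMap 2 = T * S := rfl

lemma periph_mul_periph_mul_periph : periph 0 * periph 1 * periph 2 = -1 := by
  ext i j
  fin_cases i <;> fin_cases j <;>
    simp [periph, cuspMap_zero, cuspMap_one, cuspMap_two, SL2_mul_apply, SL2_inv_zero_zero,
      SL2_inv_zero_one, SL2_inv_one_zero, SL2_inv_one_one, parA_apply, S_apply, T_apply]

lemma trace_parA_mul_conj (m : SL(2, ℤ)) :
    (parA * (m * parA * m⁻¹)) 0 0 + (parA * (m * parA * m⁻¹)) 1 1 = 2 - 4 * m 1 0 ^ 2 := by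
  have := det_eq m
  simp [SL2_mul_apply, SL2_inv_zero_zero, SL2_inv_zero_one, SL2_inv_one_zero, SL2_inv_one_one,
    parA_apply]
  linear_combination 2 * this

lemma trace_parA_mul_conj_inv (m : SL(2, ℤ)) :
    (parA * (m * parA * m⁻¹)⁻¹) 0 0 + (parA * (m * parA * m⁻¹)⁻¹) 1 1 = 2 + 4 * m 1 0 ^ 2 := by
  have := det_eq m
  simp only [SL2_mul_apply, SL2_inv_zero_zero, SL2_inv_zero_one, SL2_inv_one_zero, SL2_inv_one_one]
  simp [parA_apply]
  linear_combination 2 * this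

lemma odd_cuspMap_inv_mul {k : SL(2, ℤ)} (hk : k ∈ Gamma 2) {i j : Fin 3} (hij : i ≠ j) :
    Odd (((cuspMap i)⁻¹ * k * cuspMap j) 1 0) := by
  obtain ⟨⟨a, ha⟩, ⟨b, hb⟩, ⟨c, hc⟩, ⟨d, hd⟩⟩ := mem_Gamma_two_iff.1 hk
  rw [Int.odd_iff]
  fin_cases i <;> fin_cases j <;> first | exact absurd rfl hij | skip
  all_goals
    simp [cuspMap, SL2_mul_apply, SL2_inv_zero_zero, SL2_inv_zero_one, SL2_inv_one_zero,
      SL2_inv_one_one, S_apply, T_apply, ha, hb, hc, hd]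
  all_goals omega

/-- Conjugates of two peripheral elements whose product is parabolic. -/
lemma trace_mul_inv_of_trace_mul {k k' : SL(2, ℤ)} (hk : k ∈ Gamma 2) (hk' : k' ∈ Gamma 2)
    {i j : Fin 3} (hij : i ≠ j) {x y : SL(2, ℤ)} (hx : x = k * periph i * k⁻¹)
    (hy : y = k' * periph j * k'⁻¹) (ht : ((x * y) 0 0 + (x * y) 1 1) ^ 2 = 4) :
    (x * y⁻¹) 0 0 + (x * y⁻¹) 1 1 = 6 := by
  set m := (cuspMap i)⁻¹ * (k⁻¹ * k') * cuspMap j with hm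
  have hodd : Odd (m 1 0) := odd_cuspMap_inv_mul (mul_mem (inv_mem hk) hk') hij
  set h := k * cuspMap i with hh
  have e1 : x * y = h * (parA * (m * parA * m⁻¹)) * h⁻¹ := by
    rw [hx, hy, hh, hm, periph, periph]; group
  have e2 : x * y⁻¹ = h * (parA * (m * parA * m⁻¹)⁻¹) * h⁻¹ := by
    rw [hx, hy, hh, hm, periph, periph]; group
  rw [e1, trace_conj, trace_parA_mul_conj] at ht
  rw [e2, trace_conj, trace_parA_mul_conj_inv]
  obtain ⟨n, hn⟩ := hodd
  have h0 : m 1 0 ^ 2 * (m 1 0 ^ 2 - 1) = 0 := by linarith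
  rcases mul_eq_zero.1 h0 with h1 | h1
  · have := pow_eq_zero_iff (two_ne_zero) |>.1 h1
    omega
  · linarith

lemma trace_sq_parabolic (h : SL(2, ℤ)) (i : Fin 3) :
    ((h * periph i * h⁻¹) 0 0 + (h * periph i * h⁻¹) 1 1) ^ 2 = 4 := by
  rw [trace_conj, periph, trace_conj]; simp [parA_apply]

lemma trace_sq_mul_of_mul_mul_eq {x y z : SL(2, ℤ)} (h : x * y * z = 1 ∨ x * y * z = -1)
    (hz : (z 0 0 + z 1 1) ^ 2 = 4) : ((x * y) 0 0 + (x * y) 1 1) ^ 2 = 4 := by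
  have : x * y = z⁻¹ ∨ x * y = -z⁻¹ := by
    rcases h with h | h
    · exact .inl (eq_inv_of_mul_eq_one_left h)
    · right; rw [eq_mul_inv_of_mul_eq h, neg_one_mul]
  rcases this with h | h <;> rw [h]
  · rw [SL2_inv_zero_zero, SL2_inv_one_one, add_comm, hz]
  · rw [← hz, Matrix.SpecialLinearGroup.coe_neg, Matrix.neg_apply, Matrix.neg_apply,
      SL2_inv_zero_zero, SL2_inv_one_one]
    ring

lemma mul_mul_cycle {x y z : SL(2, ℤ)} (h : x * y * z = 1 ∨ x * y * z = -1) :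
    y * z * x = 1 ∨ y * z * x = -1 := by
  have e : y * z * x = x⁻¹ * (x * y * z) * x := by group
  rw [e]
  rcases h with h | h <;> rw [h]
  · simp
  · right; simp

lemma trace_sq_mul_comm (x y : SL(2, ℤ)) :
    ((x * y) 0 0 + (x * y) 1 1) ^ 2 = ((y * x) 0 0 + (y * x) 1 1) ^ 2 := by
  rw [← trace_conj x (y * x), show x * (y * x) * x⁻¹ = x * y by group]

lemma IsPeripheralSystem.trace_eq_six {y : Y} {c : Fin 3 → Path y y} (h : IsPeripheralSystem c)
    {w : ℍ} (hw : proj w = y) {i j : Fin 3} (hij : i ≠ j) :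
    ∃ x ∈ Gamma 2, HasLift ((c i).trans (c j).symm) w x ∧ x 0 0 + x 1 1 = 6 := by
  have hx : ∀ i, ∃ k ∈ Gamma 2, HasLift (c i) w (k * periph i * k⁻¹) := fun i => by
    obtain ⟨g, hg, hl⟩ := HasLift.exists_lift (c i) hw
    obtain ⟨k, hk, e | e⟩ := exists_conj_of_freelyHomotopic hg (periph_mem i) hl
      (hasLift_horocycle i) (h.1 i)
    · exact ⟨k, hk, e ▸ hl⟩
    · refine ⟨k, hk, ?_⟩
      have := hl.neg
      rwa [e, neg_neg] at this
  choose k hk hl using hx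
  obtain ⟨x, hxdef⟩ : ∃ x : Fin 3 → SL(2, ℤ), ∀ i, x i = k i * periph i * (k i)⁻¹ :=
    ⟨_, fun _ => rfl⟩
  simp only [← hxdef] at hl
  have hmem : ∀ i, x i ∈ Gamma 2 := fun i => hxdef i ▸ conj_mem_Gamma_two (periph_mem i) _
  have h3 : x 0 * x 1 * x 2 = 1 ∨ x 0 * x 1 * x 2 = -1 := by
    have := (((hl 0).trans (hl 1) (hmem 0)).trans (hl 2)
      (mul_mem (hmem 0) (hmem 1))).smul_eq_of_homotopic_refl h.2
    exact eq_or_eq_neg_of_smul_eq (mul_mem (mul_mem (hmem 0) (hmem 1)) (hmem 2)) (one_mem _)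
      (this.trans (one_smul _ w).symm)
  have htr : ∀ i, (x i 0 0 + x i 1 1) ^ 2 = 4 := fun i => by
    rw [hxdef]; exact trace_sq_parabolic _ _
  have t01 := trace_sq_mul_of_mul_mul_eq h3 (htr 2)
  have t12 := trace_sq_mul_of_mul_mul_eq (mul_mul_cycle h3) (htr 0)
  have t20 := trace_sq_mul_of_mul_mul_eq (mul_mul_cycle (mul_mul_cycle h3)) (htr 1)
  have ht : ((x i * x j) 0 0 + (x i * x j) 1 1) ^ 2 = 4 := by
    fin_cases i <;> fin_cases j <;> first | exact absurd rfl hij | skip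
    · exact t01
    · exact (trace_sq_mul_comm _ _).trans t20
    · exact (trace_sq_mul_comm _ _).trans t01
    · exact t12
    · exact t20
    · exact (trace_sq_mul_comm _ _).trans t12
  exact ⟨x i * (x j)⁻¹, mul_mem (hmem i) (inv_mem (hmem j)),
    (hl i).trans ((hl j).symm (hmem j)) (hmem i),
    trace_mul_inv_of_trace_mul (hk i) (hk j) hij (hxdef i) (hxdef j) ht⟩

lemma SL2_ext {a b : SL(2, ℤ)} (h₁ : a 0 0 = b 0 0) (h₂ : a 0 1 = b 0 1) (h₃ : a 1 0 = b 1 0)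
    (h₄ : a 1 1 = b 1 1) : a = b := by
  ext i j; fin_cases i <;> fin_cases j <;> assumption

lemma exists_eq_conj_parA_mul_parB_inv {g : SL(2, ℤ)} (hg : g ∈ Gamma 2)
    (ht : (g 0 0 + g 1 1) ^ 2 = 36) :
    ∃ h : SL(2, ℤ), g = h * (parA * parB⁻¹) * h⁻¹ ∨ g = -(h * (parA * parB⁻¹) * h⁻¹) := by
  obtain ⟨k, h1, h2, h3⟩ := exists_conj_of_trace_sq hg ht
  have hdet := det_eq (k * g * k⁻¹)
  have eg : g = k⁻¹ * (k * g * k⁻¹) * k := by group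
  set m := k * g * k⁻¹
  clear_value m
  suffices ∃ u : SL(2, ℤ), m = u * (parA * parB⁻¹) * u⁻¹ ∨ m = -(u * (parA * parB⁻¹) * u⁻¹) by
    obtain ⟨u, hu⟩ := this
    refine ⟨k⁻¹ * u, ?_⟩
    rw [eg]
    rcases hu with rfl | rfl
    · left; group
    · right
      rw [mul_neg, neg_mul]
      congr 1
      group
  have hcases : (m 0 0 = 5 ∧ m 1 1 = 1 ∨ m 0 0 = 1 ∧ m 1 1 = 5) ∨
      (m 0 0 = -5 ∧ m 1 1 = -1 ∨ m 0 0 = -1 ∧ m 1 1 = -5) := by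
    have hs : m 0 0 * m 1 1 = 5 := by
      rw [h1] at hdet
      rcases h2 with h | h <;> rw [h] at hdet <;> linarith
    rcases h3 with h | h
    · have : (m 0 0 - 1) * (m 0 0 + 5) = 0 := by linear_combination hs - m 0 0 * h
      rcases mul_eq_zero.1 this with e | e <;> omega
    · have : (m 0 0 - 5) * (m 0 0 + 1) = 0 := by linear_combination hs - m 0 0 * h
      rcases mul_eq_zero.1 this with e | e <;> omega
  have key : ∀ u n : SL(2, ℤ), n = u * (parA * parB⁻¹) * u⁻¹ →
    m 0 0 = n 0 0 ∧ m 1 0 = n 1 0 ∧ m 1 1 = n 1 1 ∧ n 0 1 = n 1 0 ∨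
    m 0 0 = -n 0 0 ∧ m 1 0 = -n 1 0 ∧ m 1 1 = -n 1 1 ∧ n 0 1 = n 1 0 →
    ∃ u : SL(2, ℤ), m = u * (parA * parB⁻¹) * u⁻¹ ∨ m = -(u * (parA * parB⁻¹) * u⁻¹) := by
    rintro u n rfl (⟨a, b, c, d⟩ | ⟨a, b, c, d⟩)
    · exact ⟨u, .inl (SL2_ext a (by rw [h1, d, b]) b c)⟩
    · exact ⟨u, .inr (SL2_ext a ((h1.trans b).trans (congrArg Neg.neg d.symm)) b c)⟩
  have k1 := key 1 ⟨!![5, 2; 2, 1], by simp⟩ (Subtype.ext (by decide))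
  have k2 := key parB⁻¹ ⟨!![1, 2; 2, 5], by simp⟩ (Subtype.ext (by decide))
  have k3 := key S ⟨!![1, -2; -2, 5], by simp⟩ (Subtype.ext (by decide))
  have k4 := key (parA⁻¹ * S) ⟨!![5, -2; -2, 1], by simp⟩ (Subtype.ext (by decide))
  simp at k1 k2 k3 k4
  rcases hcases with (⟨ha, hd⟩ | ⟨ha, hd⟩) | (⟨ha, hd⟩ | ⟨ha, hd⟩) <;> rcases h2 with hc | hc <;>
  first | exact k1 (by omega) | exact k2 (by omega) | exact k3 (by omega) | exact k4 (by omega)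

/-- Up to conjugation in `Γ(2)`, the conjugates of `parA * parB⁻¹` in `SL(2, ℤ)` correspond to the
ordered pairs of distinct cusps. -/
lemma exists_conj_periph (h : SL(2, ℤ)) : ∃ n ∈ Gamma 2, ∃ i j : Fin 3, i ≠ j ∧
    h * (parA * parB⁻¹) * h⁻¹ = n * (periph i * (periph j)⁻¹) * n⁻¹ := by
  have key : ∀ (ρ : SL(2, ℤ)) (i j : Fin 3), i ≠ j →
      ρ * (parA * parB⁻¹) * ρ⁻¹ = periph i * (periph j)⁻¹ → h * ρ⁻¹ ∈ Gamma 2 →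
      ∃ n ∈ Gamma 2, ∃ i j : Fin 3, i ≠ j ∧
        h * (parA * parB⁻¹) * h⁻¹ = n * (periph i * (periph j)⁻¹) * n⁻¹ :=
    fun ρ i j hij e hm => ⟨h * ρ⁻¹, hm, i, j, hij, by rw [← e]; group⟩
  have k1 := key 1 0 1 (by decide) (Subtype.ext (by decide))
  have k2 := key S 1 0 (by decide) (Subtype.ext (by decide))
  have k3 := key (S * T⁻¹) 1 2 (by decide) (Subtype.ext (by decide))
  have k4 := key (S * T⁻¹ * S) 2 1 (by decide) (Subtype.ext (by decide))
  have k5 := key (T * S) 2 0 (by decide) (Subtype.ext (by decide))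
  have k6 := key T 0 2 (by decide) (Subtype.ext (by decide))
  clear key
  generalize (∃ n ∈ Gamma 2, ∃ i j : Fin 3, i ≠ j ∧
    h * (parA * parB⁻¹) * h⁻¹ = n * (periph i * (periph j)⁻¹) * n⁻¹) = p at *
  have hdet : Odd (h 0 0 * h 1 1 - h 0 1 * h 1 0) := by rw [det_eq h]; exact odd_one
  rw [Int.odd_sub, Int.odd_mul, Int.even_mul] at hdet
  simp only [mem_Gamma_two_iff, SL2_mul_apply, SL2_inv_zero_zero, SL2_inv_zero_one,
    SL2_inv_one_zero, SL2_inv_one_one, S_apply, T_apply] at k1 k2 k3 k4 k5 k6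
  by_cases ha : Even (h 0 0) <;> by_cases hb : Even (h 0 1) <;> by_cases hc : Even (h 1 0) <;>
    by_cases hd : Even (h 1 1) <;>
    simp [← Int.not_even_iff_odd, Int.even_add, ha, hb, hc, hd] at k1 k2 k3 k4 k5 k6 hdet <;>
    assumption

lemma exists_isPeripheralSystem (w : ℍ) : ∃ c : Fin 3 → Path (proj w) (proj w),
    IsPeripheralSystem c ∧ ∀ i, HasLift (c i) w (periph i) := by
  have hP : ∀ i, ∃ c : Path (proj w) (proj w), HasLift c w (periph i) := fun i => by
    obtain ⟨P⟩ := PathConnectedSpace.joined w (periph i • w)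
    exact ⟨(P.map continuous_proj).cast rfl (proj_smul _ (periph_mem i) w).symm, P, fun _ => rfl⟩
  choose c hc using hP
  refine ⟨c, ⟨fun i => freelyHomotopic_of_hasLift (periph_mem i) (hc i) (hasLift_horocycle i), ?_⟩,
    hc⟩
  refine (((hc 0).trans (hc 1) (periph_mem 0)).trans (hc 2)
    (mul_mem (periph_mem 0) (periph_mem 1))).homotopic_refl ?_
  rw [periph_mul_periph_mul_periph]
  exact (SL_neg_smul 1 w).trans (one_smul _ w)

namespace ClosedGeodesic

lemma exists_isAxis (γ : ClosedGeodesic) : ∃ (ℓ : ℝ → ℍ) (g : SL(2, ℤ)), IsAxis ℓ γ.length g ∧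
    γ.selfIntersections = crossings ℓ γ.length ∧
    HasLift γ.loop (ℓ 0) g := by
  obtain ⟨ℓ, hℓ, hγ⟩ := γ.isGeodesic
  obtain ⟨g, hg, e⟩ := exists_smul_eq_of_proj_comp_eq (f₁ := fun t => ℓ (t + γ.length)) (f₂ := ℓ)
    (hℓ.continuous.comp (by fun_prop)) hℓ.continuous
    (fun t => by rw [← hγ, ← hγ, γ.periodic])
  refine ⟨ℓ, g, ⟨hℓ, γ.length_pos, hg, e⟩, ?_, ?_⟩
  · ext p
    simp only [selfIntersections, crossings, Set.mem_ofPred_eq, hγ]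
  · refine ⟨⟨⟨fun t => ℓ (γ.length * t), hℓ.continuous.comp (by fun_prop)⟩, by simp, ?_⟩,
      fun t => hγ _⟩
    change ℓ (γ.length * (1 : I)) = g • ℓ 0
    rw [← e 0, zero_add, Set.Icc.coe_one, mul_one]

lemma isStandardFigureEight_iff (γ : ClosedGeodesic) {w : ℍ} {g : SL(2, ℤ)} (hg : g ∈ Gamma 2)
    (hl : HasLift γ.loop w g) : γ.IsStandardFigureEight ↔ (g 0 0 + g 1 1) ^ 2 = 36 := by
  constructor
  · rintro ⟨y, c, hc, i, j, hij, hf⟩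
    obtain ⟨w', hw'⟩ : ∃ w', proj w' = y := Quotient.exists_rep y
    obtain ⟨x, hx, hlx, ht⟩ := hc.trace_eq_six hw' hij
    obtain ⟨k, -, rfl | rfl⟩ := exists_conj_of_freelyHomotopic hg hx hl hlx hf
    · rw [trace_conj, ht]; rfl
    · rw [Matrix.SpecialLinearGroup.coe_neg, Matrix.neg_apply, Matrix.neg_apply, ← neg_add,
        neg_sq, trace_conj, ht]
      rfl
  · intro ht
    obtain ⟨h, hgh⟩ := exists_eq_conj_parA_mul_parB_inv hg ht
    obtain ⟨n, hn, i, j, hij, e⟩ := exists_conj_periph h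
    rw [e] at hgh
    obtain ⟨c, hc, hcl⟩ := exists_isPeripheralSystem w
    exact ⟨_, c, hc, i, j, hij, freelyHomotopic_of_conj hl
      ((hcl i).trans ((hcl j).symm (periph_mem j)) (periph_mem i))
      (mul_mem (periph_mem i) (inv_mem (periph_mem j))) hn hgh⟩

end ClosedGeodesic

end ThricePuncturedSphere

end

theorem proposition3p1 (γ : ThricePuncturedSphere.ClosedGeodesic) :
    1 ≤ γ.selfIntersections.encard ∧
      (γ.selfIntersections.encard = 1 ↔ γ.IsStandardFigureEight) := by
  obtain ⟨ℓ, g, hA, hs, hl⟩ := γ.exists_isAxis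
  have hne := hA.crossings_nonempty
  rw [γ.isStandardFigureEight_iff hA.mem hl, hs]
  have h1 : 1 ≤ (ThricePuncturedSphere.crossings ℓ γ.length).encard :=
    Set.one_le_encard_iff_nonempty.2 hne
  refine ⟨h1, fun h => hA.trace_sq_eq_of_subsingleton ?_, fun h => le_antisymm ?_ h1⟩
  · exact Set.encard_le_one_iff_subsingleton.1 h.le
  · exact Set.encard_le_one_iff_subsingleton.2 (hA.crossings_subsingleton h)
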